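/- Let $n\ge 0$, let $SPD(n)$ be the set of real symmetric positive-definite $n\times n$ matrices, an open submanifold of the vector space $Sym(n)$ of symmetric matrices, and for $A\in SPD(n)$ and a matrix $X$ let $\Gamma_A[X]$ be the unique matrix with $A\,\Gamma_A[X]+\Gamma_A[X]\,A=X$. Let $g_W$ be the Riemannian metric on $SPD(n)$ given by $g_W|_A(X,Y)=\mathrm{tr}\left(\Gamma_A[Y]\,A\,\Gamma_A[X]\right)$ for $X,Y\in T_ASPD(n)=Sym(n)$, let $d$ be its Riemannian distance (the infimum of the lengths of $C^1$ paths), and call a $C^2$ curve $\gamma$ a geodesic if $\nabla_{\dot\gamma}\dot\gamma=0$ for the Levi-Civita connection $\nabla$ of $g_W$. Theorem. (i) For all $A_1,A_2\in SPD(n)$ there is exactly one geodesic $\gamma:[0,1]\to SPD(n)$ with $\gamma(0)=A_1$ and $\gamma(1)=A_2$, and its length is $d(A_1,A_2)$. (ii) For all $A_1,A_2\in SPD(n)$ the matrix $A_1A_2$ has exactly one real square root all of whose complex eigenvalues have positive real part. If $(A_1A_2)^{1/2}$ denotes this root, then $\mathrm{tr}A_1+\mathrm{tr}A_2-2\,\mathrm{tr}(A_1A_2)^{1/2}\ge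 0$ and $$d(A_1,A_2)=\left(\mathrm{tr}A_1+\mathrm{tr}A_2-2\,\mathrm{tr}(A_1A_2)^{1/2}\right)^{1/2}=\min_{P_1,P_2\in O(n)}\left\|P_1A_1^{1/2}-P_2A_2^{1/2}\right\|,$$ where $\|M\|=(\mathrm{tr}\,M^TM)^{1/2}$ and the minimum is attained. Here $\{PA^{1/2}: P\in O(n)\}$ is, for each $A\in SPD(n)$, the fiber $\{M\in GL(n): M^TM=A\}$ of the map $GL(n)\to SPD(n)$, $M\mapsto M^TM$. (iii) For every $A\in SPD(n)$ the cut locus of $A$ is empty: there are no nonconstant geodesic $\gamma:[0,b)\to SPD(n)$ with $\gamma(0)=A$ and $t_0\in(0,b)$ such that the length of $\gamma|_{[0,t]}$ equals $d(A,\gamma(t))$ for $t=t_0$ but for no $t\in(t_0,b)$. -/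

import Mathlib

open Set Matrix Manifold
open scoped ContDiff ENNReal MatrixOrder

-- So that the manifold structure of a normed space is found to be `chartedSpaceSelf`.
attribute [-instance] TopCat.of.chartedSpace

namespace BuresWasserstein

variable {n : ℕ}

/-! ### The manifold of symmetric positive-definite matrices -/

section

attribute [local instance] Matrix.normedAddCommGroup Matrix.normedSpace

/-- The subspace of symmetric matrices in `M(n)`. -/
def symSubmodule (n : ℕ) : Submodule ℝ (Matrix (Fin n) (Fin n) ℝ) where
  carrier := {X | X.IsSymm}
  add_mem' h₁ h₂ := Matrix.IsSymm.add h₁ h₂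
  zero_mem' := Matrix.isSymm_zero
  smul_mem' c _ h := Matrix.IsSymm.smul h c

/-- The vector space `Sym(n)` of real symmetric `n × n` matrices. It is normed by the maximum of
the absolute values of the entries; the norm serves only to define derivatives. -/
def SymMat (n : ℕ) : Type := symSubmodule n

noncomputable instance : NormedAddCommGroup (SymMat n) :=
  inferInstanceAs (NormedAddCommGroup (symSubmodule n))

noncomputable instance : NormedSpace ℝ (SymMat n) :=
  inferInstanceAs (NormedSpace ℝ (symSubmodule n))

instance : FiniteDimensional ℝ (SymMat n) :=
  inferInstanceAs (FiniteDimensional ℝ (symSubmodule n))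

/-- The inclusion `Sym(n) ⊆ M(n)`. -/
def SymMat.mat : SymMat n →ₗ[ℝ] Matrix (Fin n) (Fin n) ℝ := (symSubmodule n).subtype

theorem SymMat.isSymm (X : SymMat n) : X.mat.IsSymm := Subtype.property X

theorem SymMat.continuous_mat : Continuous (SymMat.mat : SymMat n → Matrix (Fin n) (Fin n) ℝ) :=
  (continuous_subtype_val : Continuous (Subtype.val : symSubmodule n → _))

end

theorem isOpen_posDef (n : ℕ) : IsOpen {A : SymMat n | A.mat.PosDef} := by
  have key : ∀ A : SymMat n, A.mat.PosDef ↔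
      ∀ x ∈ Metric.sphere (0 : Fin n → ℝ) 1, 0 < x ⬝ᵥ (A.mat *ᵥ x) := by
    intro A
    have hA : A.mat.IsHermitian := by
      rw [Matrix.IsHermitian, Matrix.conjTranspose_eq_transpose_of_trivial]
      exact A.isSymm
    constructor
    · intro h x hx
      have hx0 : x ≠ 0 := by
        rintro rfl
        simp at hx
      simpa using h.dotProduct_mulVec_pos hx0
    · intro h
      refine Matrix.PosDef.of_dotProduct_mulVec_pos hA fun x hx => ?_
      have hn : 0 < ‖x‖ := norm_pos_iff.mpr hx
      have h1 := h (‖x‖⁻¹ • x) (by simp [norm_smul, hn.ne'])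
      rw [Matrix.mulVec_smul, smul_dotProduct, dotProduct_smul, smul_eq_mul, smul_eq_mul] at h1
      have h2 : 0 < ‖x‖⁻¹ := inv_pos.mpr hn
      simpa using (pos_of_mul_pos_right (pos_of_mul_pos_right h1 h2.le) h2.le)
  rw [isOpen_iff_mem_nhds]
  intro A hA
  have hA' := (key A).1 hA
  have hm := SymMat.continuous_mat (n := n)
  have hc : Continuous fun p : SymMat n × (Fin n → ℝ) => p.2 ⬝ᵥ (p.1.mat *ᵥ p.2) :=
    continuous_snd.dotProduct ((hm.comp continuous_fst).matrix_mulVec continuous_snd)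
  have h := (isCompact_sphere (0 : Fin n → ℝ) 1).eventually_forall_of_forall_eventually
    (x₀ := A) (P := fun (B : SymMat n) x => 0 < x ⬝ᵥ (B.mat *ᵥ x))
    (fun x hx => (isOpen_lt continuous_const hc).mem_nhds
      (show (A, x) ∈ {p : SymMat n × (Fin n → ℝ) | 0 < p.2 ⬝ᵥ (p.1.mat *ᵥ p.2)} from hA' x hx))
  filter_upwards [h] with B hB
  exact (key B).2 hB

/-- The set of positive-definite matrices, as an open subset of `Sym(n)`. -/
noncomputable def spdOpens (n : ℕ) : TopologicalSpace.Opens (SymMat n) :=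
  ⟨{A : SymMat n | A.mat.PosDef}, isOpen_posDef n⟩

/-- The manifold `SPD(n)` of symmetric positive-definite matrices, an open submanifold of
`Sym(n)`. -/
abbrev SPD (n : ℕ) : Type := spdOpens n

/-- The point of `Sym(n)` given by a point of `SPD(n)`. -/
noncomputable def SPD.sym (A : SPD n) : SymMat n := A.1

/-- The matrix underlying a point of `SPD(n)`. -/
noncomputable def SPD.mat (A : SPD n) : Matrix (Fin n) (Fin n) ℝ := A.sym.mat

/-! ### The Wasserstein metric -/

/-- The Sylvester operator `G ↦ A G + G A` on `M(n)`. -/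
noncomputable def sylvesterOp (A : Matrix (Fin n) (Fin n) ℝ) :
    Module.End ℝ (Matrix (Fin n) (Fin n) ℝ) :=
  LinearMap.mulLeft ℝ A + LinearMap.mulRight ℝ A

/-- `Γ_A[X]`, the solution `G` of the Sylvester equation `A G + G A = X`. -/
noncomputable def sylvester (A X : Matrix (Fin n) (Fin n) ℝ) : Matrix (Fin n) (Fin n) ℝ :=
  Ring.inverse (sylvesterOp A) X

theorem sylvesterOp_apply (A G : Matrix (Fin n) (Fin n) ℝ) :
    sylvesterOp A G = A * G + G * A := by
  simp [sylvesterOp]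

theorem sylvesterOp_injective {A : Matrix (Fin n) (Fin n) ℝ} (hA : A.PosDef) :
    Function.Injective (sylvesterOp A) := by
  rw [injective_iff_map_eq_zero]
  intro G hG
  rw [sylvesterOp_apply] at hG
  have h1 : (Gᵀ * A * G).trace + (G * A * Gᵀ).trace = 0 := by
    rw [Matrix.trace_mul_comm (G * A) Gᵀ, Matrix.mul_assoc, ← Matrix.trace_add,
      ← Matrix.mul_add, hG]
    simp
  have p1 : (Gᵀ * A * G).PosSemidef := by
    simpa using hA.posSemidef.conjTranspose_mul_mul_same G
  have p2 : (G * A * Gᵀ).PosSemidef := by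
    simpa using hA.posSemidef.mul_mul_conjTranspose_same G
  have h2 : (Gᵀ * A * G).trace = 0 := by
    have := p1.trace_nonneg
    have := p2.trace_nonneg
    linarith
  have h3 := p1.trace_eq_zero_iff.1 h2
  by_contra hne
  obtain ⟨v, hv⟩ : ∃ v, G *ᵥ v ≠ 0 := by
    by_contra! hall
    exact hne (Matrix.ext_of_mulVec_single fun i => by rw [hall, Matrix.zero_mulVec])
  have h4 := hA.dotProduct_mulVec_pos hv
  have h5 : star (G *ᵥ v) ⬝ᵥ (A *ᵥ (G *ᵥ v)) = v ⬝ᵥ ((Gᵀ * A * G) *ᵥ v) := by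
    simp [Matrix.dotProduct_mulVec, Matrix.vecMul_mulVec, ← Matrix.mulVec_mulVec,
      Matrix.vecMul_transpose]
  rw [h5, h3] at h4
  simp at h4

/-- For positive-definite `A`, the matrix `Γ_A[X]` is the unique solution of the Sylvester
equation. -/
theorem sylvester_eq_iff {A : Matrix (Fin n) (Fin n) ℝ} (hA : A.PosDef)
    (X G : Matrix (Fin n) (Fin n) ℝ) : sylvester A X = G ↔ A * G + G * A = X := by
  have hinj := sylvesterOp_injective hA
  have hu : IsUnit (sylvesterOp A) := by
    rw [Module.End.isUnit_iff]
    exact ⟨hinj, LinearMap.injective_iff_surjective.1 hinj⟩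
  have hs : sylvesterOp A (sylvester A X) = X := by
    have := congrArg (fun f => f X) (Ring.mul_inverse_cancel _ hu)
    simpa [sylvester] using this
  rw [← sylvesterOp_apply]
  constructor
  · rintro rfl
    exact hs
  · intro h
    exact hinj (hs.trans h.symm)

/-- The Wasserstein metric `g_W|_A(X, Y) = tr(Γ_A[Y] A Γ_A[X])`, for `X, Y ∈ T_A SPD(n) = Sym(n)`. -/
noncomputable def metric (A X Y : SymMat n) : ℝ :=
  (sylvester A.mat Y.mat * A.mat * sylvester A.mat X.mat).trace

/-- The length `√(g_W|_A(X, X))` of a tangent vector `X ∈ T_A SPD(n) = Sym(n)`. With it, Mathlib's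
`Manifold.pathELength` and `Manifold.riemannianEDist` are the length of curves and the Riemannian
(geodesic) distance of `(SPD(n), g_W)`. -/
noncomputable instance instENormTangentSpace (A : SPD n) :
    ENorm (TangentSpace 𝓘(ℝ, SymMat n) A) where
  enorm X := ENNReal.ofReal (Real.sqrt (metric A.sym (show SymMat n from X) (show SymMat n from X)))

/-! ### Geodesics -/

/-- Christoffel symbols of the first kind of the Levi-Civita connection of `g_W`, in the global
chart `SPD(n) ⊆ Sym(n)`: for constant vector fields `X, Y, Z`, this is
`g_W(∇_X Y, Z) = (X g_W(Y, Z) + Y g_W(X, Z) - Z g_W(X, Y)) / 2` at the point `A`. -/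
noncomputable def christoffel (A X Y Z : SymMat n) : ℝ :=
  (fderiv ℝ (fun B => metric B Y Z) A X + fderiv ℝ (fun B => metric B X Z) A Y
    - fderiv ℝ (fun B => metric B X Y) A Z) / 2

/-- A curve in `SPD(n)`, seen in the vector space `Sym(n)`. -/
noncomputable def curve (γ : ℝ → SPD n) (t : ℝ) : SymMat n := (γ t).sym

/-- `γ` is a geodesic of `(SPD(n), g_W)` on the nondegenerate interval `I`: a `C²` curve with
`g_W(∇_{γ'} γ', Z) = 0` for all `Z`, where `∇` is the Levi-Civita connection (equivalently, a smooth
curve with this property). Derivatives are one-sided at the end points of `I`; the values of `γ`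
outside of `I` are irrelevant. -/
def IsGeodesicOn (γ : ℝ → SPD n) (I : Set ℝ) : Prop :=
  ContDiffOn ℝ 2 (curve γ) I ∧
  ∀ t ∈ I, ∀ Z : SymMat n,
    metric (curve γ t) (derivWithin (derivWithin (curve γ) I) I t) Z
      + christoffel (curve γ t) (derivWithin (curve γ) I t) (derivWithin (curve γ) I t) Z = 0

/-- `γ` restricted to `[a, b]` realizes the Riemannian distance between its end points. -/
def IsMinimizing (γ : ℝ → SPD n) (a b : ℝ) : Prop :=
  pathELength 𝓘(ℝ, SymMat n) γ a b = riemannianEDist 𝓘(ℝ, SymMat n) (γ a) (γ b)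

/-- `t₀` is the cut time of the nonconstant geodesic `γ : [0, b) → SPD(n)`: the curve `γ` is
minimizing up to time `t₀`, but not up to any later time. -/
def IsCutTime (γ : ℝ → SPD n) (b t₀ : ℝ) : Prop :=
  IsGeodesicOn γ (Ico 0 b) ∧ derivWithin (curve γ) (Ico 0 b) 0 ≠ 0 ∧
  0 < t₀ ∧ t₀ < b ∧ IsMinimizing γ 0 t₀ ∧ ∀ t, t₀ < t → t < b → ¬ IsMinimizing γ 0 t

/-- The cut locus of `A`: the set of all cut points of `A` along geodesics issuing from `A`. -/
def cutLocus (A : SPD n) : Set (SPD n) :=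
  {B | ∃ (γ : ℝ → SPD n) (b t₀ : ℝ), γ 0 = A ∧ IsCutTime γ b t₀ ∧ γ t₀ = B}

/-! ### The Bures–Wasserstein distance and the fibers of `GL(n) → SPD(n)` -/

/-- `R = M^{1/2}`: `R` is a principal square root of `M`, that is, `R² = M` and all complex
eigenvalues of `R` have positive real part. -/
def IsPrincipalSqrt (M R : Matrix (Fin n) (Fin n) ℝ) : Prop :=
  R * R = M ∧ ∀ z ∈ spectrum ℂ (R.map (algebraMap ℝ ℂ)), 0 < z.re

/-- The Frobenius norm `‖M‖ = (tr Mᵀ M)^{1/2}`, that is, the norm of the Euclidean metric on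
`GL(n)`. -/
noncomputable def frobNorm (M : Matrix (Fin n) (Fin n) ℝ) : ℝ := Real.sqrt (Mᵀ * M).trace

/-- The fiber over `A` of the projection `σ : GL(n) → SPD(n)`, `σ(M) = Mᵀ M`. -/
def fiber (A : SPD n) : Set (Matrix (Fin n) (Fin n) ℝ) :=
  {M | IsUnit M ∧ Mᵀ * M = A.mat}

end BuresWasserstein

open BuresWasserstein

namespace BuresWasserstein

variable {n : ℕ}

/-! ### Positive-definite matrices and principal square roots -/

/-! For positive-definite `A`, `B` there is exactly one positive-definite `T` with `T A T = B`, and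
`A T` is then the principal square root of `A B`. Hence `tr A + tr B - 2 tr (AB)^{1/2} = tr((T-1) A
(T-1))`, and the task is to recognize this number as the squared distance.

Write a velocity as `V = A G + G A`, so that `G = Γ_A[V]`. Along a geodesic `G` obeys the Riccati
equation `G' = -G²`, in which the base point no longer appears. Thus geodesics are `(1 + t G₀) A (1
+ t G₀)` (`IsGeodesicOn.eq_flow`). As the curve stays positive definite, `1 + t G₀` never becomes
singular, hence stays positive definite: it is the matrix `T` from `A` to the point at time `t`.
Existence and uniqueness on `[0, 1]` follow, with `G₀ = T - 1`, and the speed is constant.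

The lower bound for arbitrary curves is a calibration. With `S = T - 1`, the matrices `P_s = S (1 +
s S)⁻¹` also solve the Riccati equation, so the functions `B ↦ tr(P_s B)` bound energy from below
(`calibration_le`); running `s` along the curve almost at arc length turns this into a bound for the
length (`trace_le_sq_length`). The bound holds at every time for which a geodesic exists, so
geodesics from `A` minimize throughout and there is no cut point.

The distance between fibers is a separate trace inequality, `trace_transpose_mul_le`, with equality
at `M = N T`. -/

theorem isSymm_of_posDef {A : Matrix (Fin n) (Fin n) ℝ} (hA : A.PosDef) : A.IsSymm := by
  have := hA.isHermitian
  rwa [Matrix.IsHermitian, Matrix.conjTranspose_eq_transpose_of_trivial] at this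

theorem posDef_sqrt {A : Matrix (Fin n) (Fin n) ℝ} (hA : A.PosDef) : (CFC.sqrt A).PosDef := by
  have h0 : (CFC.sqrt A).PosSemidef := Matrix.nonneg_iff_posSemidef.1 (CFC.sqrt_nonneg A)
  rw [h0.posDef_iff_isUnit]
  have h1 : CFC.sqrt A * CFC.sqrt A = A :=
    CFC.sqrt_mul_sqrt_self A (Matrix.nonneg_iff_posSemidef.2 hA.posSemidef)
  have h2 := hA.isUnit
  rw [← h1] at h2
  exact isUnit_of_mul_isUnit_left h2

theorem sqrt_mul_sqrt {A : Matrix (Fin n) (Fin n) ℝ} (hA : A.PosDef) :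
    CFC.sqrt A * CFC.sqrt A = A :=
  CFC.sqrt_mul_sqrt_self A (Matrix.nonneg_iff_posSemidef.2 hA.posSemidef)

theorem posDef_transpose_mul_mul {A B : Matrix (Fin n) (Fin n) ℝ} (hA : A.PosDef)
    (hB : IsUnit B) : (Bᵀ * A * B).PosDef := by
  have := hA.conjTranspose_mul_mul_same (Matrix.mulVec_injective_iff_isUnit.2 hB)
  rwa [Matrix.conjTranspose_eq_transpose_of_trivial] at this

theorem posDef_mul_mul {A B : Matrix (Fin n) (Fin n) ℝ} (hA : A.PosDef)
    (hB : B.PosDef) : (B * A * B).PosDef := by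
  have := posDef_transpose_mul_mul hA hB.isUnit
  rwa [(isSymm_of_posDef hB).eq] at this

/-- The optimal transport map between two positive-definite matrices. -/
theorem exists_posDef_transport {A B : Matrix (Fin n) (Fin n) ℝ} (hA : A.PosDef)
    (hB : B.PosDef) : ∃ T : Matrix (Fin n) (Fin n) ℝ, T.PosDef ∧ T * A * T = B := by
  have hS := posDef_sqrt hA
  have hK := posDef_mul_mul hB hS
  refine ⟨(CFC.sqrt A)⁻¹ * CFC.sqrt (CFC.sqrt A * B * CFC.sqrt A) * (CFC.sqrt A)⁻¹,
    posDef_mul_mul (posDef_sqrt hK) hS.inv, ?_⟩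
  have h1 := sqrt_mul_sqrt hA
  have h2 := sqrt_mul_sqrt hK
  set S := CFC.sqrt A
  set L := CFC.sqrt (S * B * S)
  have hu : IsUnit S.det := (Matrix.isUnit_iff_isUnit_det S).1 hS.isUnit
  calc S⁻¹ * L * S⁻¹ * A * (S⁻¹ * L * S⁻¹)
      = S⁻¹ * L * (S⁻¹ * S) * (S * S⁻¹) * L * S⁻¹ := by rw [← h1]; noncomm_ring
    _ = S⁻¹ * (L * L) * S⁻¹ := by
        rw [Matrix.nonsing_inv_mul _ hu, Matrix.mul_nonsing_inv _ hu]; noncomm_ring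
    _ = (S⁻¹ * S) * B * (S * S⁻¹) := by rw [h2]; noncomm_ring
    _ = B := by rw [Matrix.nonsing_inv_mul _ hu, Matrix.mul_nonsing_inv _ hu]; simp

theorem aeval_mul_eq_mul_aeval {R : Type*} [Ring R] [Algebra ℂ R] {P Q X : R}
    (h : P * X = X * Q) (p : Polynomial ℂ) :
    Polynomial.aeval P p * X = X * Polynomial.aeval Q p := by
  induction p using Polynomial.induction_on' with
  | add p q hp hq => simp [add_mul, mul_add, hp, hq]
  | monomial k a =>
    have hk : P ^ k * X = X * Q ^ k := (SemiconjBy.pow_right (show SemiconjBy X Q P from h.symm) k).symm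
    simp only [Polynomial.aeval_monomial, mul_assoc, hk]
    rw [← mul_assoc, Algebra.commutes, mul_assoc]

/-- Uniqueness for the Sylvester equation when the spectra are disjoint. -/
theorem eq_zero_of_sylvester {P Q X : Matrix (Fin n) (Fin n) ℂ} (h : P * X = X * Q)
    (hd : ∀ z ∈ spectrum ℂ P, z ∉ spectrum ℂ Q) : X = 0 := by
  rcases subsingleton_or_nontrivial (Matrix (Fin n) (Fin n) ℂ) with hs | hn
  · exact Subsingleton.elim _ _
  -- Cayley–Hamilton kills the left side, while the characteristic polynomial of `P` evaluated at
  -- `Q` is invertible by spectral mapping; so `X = 0`.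
  have h1 := aeval_mul_eq_mul_aeval h P.charpoly
  rw [Matrix.aeval_self_charpoly, zero_mul] at h1
  have hu : IsUnit (Polynomial.aeval Q P.charpoly) := by
    by_contra hu
    have h0 : (0 : ℂ) ∈ spectrum ℂ (Polynomial.aeval Q P.charpoly) := by
      rwa [spectrum.zero_mem_iff]
    rw [spectrum.map_polynomial_aeval_of_nonempty Q _
      (spectrum.nonempty_of_isAlgClosed_of_finiteDimensional ℂ Q)] at h0
    obtain ⟨z, hz, hz0⟩ := h0
    exact hd z (Matrix.mem_spectrum_iff_isRoot_charpoly.2 hz0) hz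
  exact (hu.mul_left_eq_zero).1 h1.symm

/-- Since `R² = S²`, the difference intertwines `R` with `-S`, whose spectra lie in opposite open
half planes. -/
theorem IsPrincipalSqrt.unique {M R S : Matrix (Fin n) (Fin n) ℝ} (hR : IsPrincipalSqrt M R)
    (hS : IsPrincipalSqrt M S) : R = S := by
  let f := (algebraMap ℝ ℂ).mapMatrix (m := Fin n)
  have h : R * (R - S) = (R - S) * (-S) := by
    have : R * R = S * S := hR.1.trans hS.1.symm
    have h2 : R * (R - S) - (R - S) * (-S) = R * R - S * S := by noncomm_ring
    rw [this, sub_self] at h2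
    exact sub_eq_zero.1 h2
  have h' : f R * f (R - S) = f (R - S) * (- f S) := by
    rw [← map_neg, ← map_mul, ← map_mul, h]
  have h0 := eq_zero_of_sylvester h' (by
    intro z hz hz'
    rw [← spectrum.neg_eq, Set.mem_neg] at hz'
    have h1 := hR.2 z hz
    have h2 := hS.2 _ hz'
    rw [Complex.neg_re] at h2
    linarith)
  have hinj : Function.Injective f := Matrix.map_injective (algebraMap ℝ ℂ).injective
  exact sub_eq_zero.1 (hinj (h0.trans (map_zero f).symm))

/-- `A T` has the characteristic polynomial of the positive-definite `A^{1/2} T A^{1/2}`, so its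
eigenvalues are positive reals. -/
theorem isPrincipalSqrt_mul {A T : Matrix (Fin n) (Fin n) ℝ} (hA : A.PosDef) (hT : T.PosDef) :
    IsPrincipalSqrt (A * (T * A * T)) (A * T) := by
  refine ⟨by noncomm_ring, fun z hz => ?_⟩
  have hK := posDef_mul_mul hT (posDef_sqrt hA)
  have hc : (A * T).charpoly = (CFC.sqrt A * T * CFC.sqrt A).charpoly := by
    rw [Matrix.charpoly_mul_comm (CFC.sqrt A * T), ← mul_assoc, sqrt_mul_sqrt hA]
  rw [Matrix.mem_spectrum_iff_isRoot_charpoly, Matrix.charpoly_map, hc,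
    hK.isHermitian.charpoly_eq, Polynomial.map_prod, Polynomial.IsRoot, Polynomial.eval_prod,
    Finset.prod_eq_zero_iff] at hz
  obtain ⟨i, -, hi⟩ := hz
  simp only [Polynomial.map_sub, Polynomial.map_X, Polynomial.map_C, Polynomial.eval_sub,
    Polynomial.eval_X, Polynomial.eval_C, sub_eq_zero] at hi
  rw [hi]
  simpa using hK.eigenvalues_pos i

theorem transport_unique {A T T' : Matrix (Fin n) (Fin n) ℝ} (hA : A.PosDef) (hT : T.PosDef)
    (hT' : T'.PosDef) (h : T * A * T = T' * A * T') : T = T' := by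
  have h1 := isPrincipalSqrt_mul hA hT
  rw [h] at h1
  exact hA.isUnit.mul_left_cancel (h1.unique (isPrincipalSqrt_mul hA hT'))

/-! ### The fibers of `GL(n) → SPD(n)` -/

theorem fiber_eq_orthogonal_mul_sqrt {A : Matrix (Fin n) (Fin n) ℝ} (hA : A.PosDef)
    (M : Matrix (Fin n) (Fin n) ℝ) :
    Mᵀ * M = A ↔ ∃ P ∈ Matrix.orthogonalGroup (Fin n) ℝ, M = P * CFC.sqrt A := by
  have hS := posDef_sqrt hA
  have h1 := sqrt_mul_sqrt hA
  have hs := (isSymm_of_posDef hS).eq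
  have hu : IsUnit (CFC.sqrt A).det := (Matrix.isUnit_iff_isUnit_det _).1 hS.isUnit
  set S := CFC.sqrt A
  constructor
  · intro h
    refine ⟨M * S⁻¹, ?_, by rw [mul_assoc, Matrix.nonsing_inv_mul _ hu, mul_one]⟩
    rw [Matrix.mem_orthogonalGroup_iff', Matrix.transpose_mul,
      Matrix.transpose_nonsing_inv, hs]
    calc S⁻¹ * Mᵀ * (M * S⁻¹) = S⁻¹ * (Mᵀ * M) * S⁻¹ := by noncomm_ring
      _ = (S⁻¹ * S) * (S * S⁻¹) := by rw [h, ← h1]; noncomm_ring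
      _ = 1 := by rw [Matrix.nonsing_inv_mul _ hu, Matrix.mul_nonsing_inv _ hu, one_mul]
  · rintro ⟨P, hP, rfl⟩
    rw [Matrix.mem_orthogonalGroup_iff'] at hP
    rw [Matrix.transpose_mul, hs]
    calc S * Pᵀ * (P * S) = S * (Pᵀ * P) * S := by noncomm_ring
      _ = A := by rw [hP, mul_one, h1]

theorem isUnit_of_transpose_mul_self {A M : Matrix (Fin n) (Fin n) ℝ} (hA : A.PosDef)
    (h : Mᵀ * M = A) : IsUnit M := by
  have := hA.isUnit
  rw [← h] at this
  exact isUnit_of_mul_isUnit_right this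

/-- Expand `tr((N T - M) T⁻¹ (N T - M)ᵀ) ≥ 0`; the left side is `2 tr(A T) - 2 tr(Nᵀ M)`. -/
theorem trace_transpose_mul_le {A T N M : Matrix (Fin n) (Fin n) ℝ} (hT : T.PosDef)
    (hN : Nᵀ * N = A) (hM : Mᵀ * M = T * A * T) : (Nᵀ * M).trace ≤ (A * T).trace := by
  have hu : IsUnit T.det := (Matrix.isUnit_iff_isUnit_det _).1 hT.isUnit
  have hs := (isSymm_of_posDef hT).eq
  have h0 := (hT.inv.posSemidef.mul_mul_conjTranspose_same (N * T - M)).trace_nonneg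
  rw [Matrix.conjTranspose_eq_transpose_of_trivial, Matrix.transpose_sub, Matrix.transpose_mul,
    hs] at h0
  have e : (N * T - M) * T⁻¹ * (T * Nᵀ - Mᵀ)
      = N * (T * T⁻¹) * T * Nᵀ - N * (T * T⁻¹) * Mᵀ - M * (T⁻¹ * T) * Nᵀ + M * T⁻¹ * Mᵀ := by
    noncomm_ring
  rw [e, Matrix.nonsing_inv_mul _ hu, Matrix.mul_nonsing_inv _ hu, mul_one, mul_one,
    Matrix.trace_add, Matrix.trace_sub, Matrix.trace_sub] at h0
  have e1 : (N * T * Nᵀ).trace = (A * T).trace := by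
    rw [Matrix.trace_mul_comm, ← mul_assoc, hN]
  have e2 : (N * Mᵀ).trace = (Nᵀ * M).trace := by
    rw [← Matrix.trace_transpose, Matrix.transpose_mul, Matrix.transpose_transpose,
      Matrix.trace_mul_comm]
  have e3 : (M * Nᵀ).trace = (Nᵀ * M).trace := Matrix.trace_mul_comm _ _
  have e4 : (M * T⁻¹ * Mᵀ).trace = (A * T).trace := by
    rw [Matrix.trace_mul_comm, ← mul_assoc, hM, mul_assoc, Matrix.mul_nonsing_inv _ hu, mul_one,
      Matrix.trace_mul_comm]
  rw [e1, e2, e3, e4] at h0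
  linarith

theorem trace_sub_transpose_mul_sub (N M : Matrix (Fin n) (Fin n) ℝ) :
    ((N - M)ᵀ * (N - M)).trace
      = (Nᵀ * N).trace + (Mᵀ * M).trace - 2 * (Nᵀ * M).trace := by
  have e : (Mᵀ * N).trace = (Nᵀ * M).trace := by
    rw [← Matrix.trace_transpose, Matrix.transpose_mul, Matrix.transpose_transpose]
  simp only [Matrix.transpose_sub, Matrix.sub_mul, Matrix.mul_sub, Matrix.trace_sub, e]
  ring

theorem isLeast_frobNorm_sub {A T : Matrix (Fin n) (Fin n) ℝ} (hA : A.PosDef) (hT : T.PosDef) :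
    IsLeast {r : ℝ | ∃ P₁ ∈ Matrix.orthogonalGroup (Fin n) ℝ,
        ∃ P₂ ∈ Matrix.orthogonalGroup (Fin n) ℝ,
          r = frobNorm (P₁ * CFC.sqrt A - P₂ * CFC.sqrt (T * A * T))}
      (Real.sqrt (A.trace + (T * A * T).trace - 2 * (A * T).trace)) := by
  have hB := posDef_mul_mul hA hT
  have hs := (isSymm_of_posDef hT).eq
  constructor
  · have h1 : (CFC.sqrt A)ᵀ * CFC.sqrt A = A := by
      rw [(isSymm_of_posDef (posDef_sqrt hA)).eq, sqrt_mul_sqrt hA]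
    -- The equality case `M = N T` with `N = A^{1/2}`: this `M` lies in the fiber over `T A T`.
    have h2 : (CFC.sqrt A * T)ᵀ * (CFC.sqrt A * T) = T * A * T := by
      rw [Matrix.transpose_mul, hs, mul_assoc, ← mul_assoc _ (CFC.sqrt A), h1, ← mul_assoc]
    obtain ⟨P, hP, hPe⟩ := (fiber_eq_orthogonal_mul_sqrt hB _).1 h2
    refine ⟨1, one_mem _, P, hP, ?_⟩
    rw [← hPe, one_mul, frobNorm, trace_sub_transpose_mul_sub, h1, h2, ← mul_assoc, h1]
  · rintro r ⟨P₁, hP₁, P₂, hP₂, rfl⟩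
    have h1 := (fiber_eq_orthogonal_mul_sqrt hA _).2 ⟨P₁, hP₁, rfl⟩
    have h2 := (fiber_eq_orthogonal_mul_sqrt hB _).2 ⟨P₂, hP₂, rfl⟩
    rw [frobNorm, trace_sub_transpose_mul_sub, h1, h2]
    have := trace_transpose_mul_le hT h1 h2
    apply Real.sqrt_le_sqrt
    linarith

theorem trace_add_trace_sub {A T : Matrix (Fin n) (Fin n) ℝ} :
    A.trace + (T * A * T).trace - 2 * (A * T).trace = ((T - 1) * A * (T - 1)).trace := by
  have e : (T - 1) * A * (T - 1) = T * A * T - T * A - A * T + A := by noncomm_ring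
  rw [e, Matrix.trace_add, Matrix.trace_sub, Matrix.trace_sub, Matrix.trace_mul_comm T A]
  ring

/-! ### Smoothness of the solution of the Sylvester equation -/

theorem map_ring_inverse {R S : Type*} [Ring R] [Ring S] (e : R ≃+* S) (a : R) :
    Ring.inverse (e a) = e (Ring.inverse a) := by
  by_cases ha : IsUnit a
  · have h1 : e a * e (Ring.inverse a) = 1 := by
      rw [← map_mul, Ring.mul_inverse_cancel _ ha, map_one]
    calc Ring.inverse (e a) = Ring.inverse (e a) * (e a * e (Ring.inverse a)) := by
          rw [h1, mul_one]
      _ = e (Ring.inverse a) := by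
          rw [← mul_assoc, Ring.inverse_mul_cancel _ (ha.map e), one_mul]
  · rw [Ring.inverse_non_unit _ ha, Ring.inverse_non_unit, map_zero]
    rwa [MulEquiv.isUnit_map]

theorem sylvester_mul_add {A : Matrix (Fin n) (Fin n) ℝ} (hA : A.PosDef)
    (X : Matrix (Fin n) (Fin n) ℝ) : A * sylvester A X + sylvester A X * A = X :=
  (sylvester_eq_iff hA X _).1 rfl

theorem isSymm_sylvester {A X : Matrix (Fin n) (Fin n) ℝ} (hA : A.PosDef) (hX : X.IsSymm) :
    (sylvester A X).IsSymm := by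
  refine ((sylvester_eq_iff hA X _).2 ?_).symm
  have h := congrArg Matrix.transpose (sylvester_mul_add hA X)
  rw [Matrix.transpose_add, Matrix.transpose_mul, Matrix.transpose_mul, hX.eq,
    (isSymm_of_posDef hA).eq] at h
  rw [add_comm, h]

theorem trace_sylvester_mul {A : Matrix (Fin n) (Fin n) ℝ} (hA : A.PosDef)
    (X Y : Matrix (Fin n) (Fin n) ℝ) :
    (sylvester A X * Y).trace = (X * sylvester A Y).trace := by
  conv_lhs => rw [← sylvester_mul_add hA Y]
  conv_rhs => rw [← sylvester_mul_add hA X]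
  rw [mul_add, add_mul, Matrix.trace_add, Matrix.trace_add, ← mul_assoc, ← mul_assoc,
    Matrix.trace_mul_comm _ A, ← mul_assoc, add_comm]

/-- The inclusion `Sym(n) ⊆ M(n)` has a partial inverse. -/
def SymMat.ofMat (M : Matrix (Fin n) (Fin n) ℝ) (h : M.IsSymm) : SymMat n :=
  (⟨M, h⟩ : symSubmodule n)

@[simp] theorem SymMat.mat_ofMat (M : Matrix (Fin n) (Fin n) ℝ) (h : M.IsSymm) :
    (SymMat.ofMat M h).mat = M := rfl

theorem SymMat.mat_injective :
    Function.Injective (SymMat.mat : SymMat n → Matrix (Fin n) (Fin n) ℝ) :=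
  Subtype.val_injective

/-- Substituting `Y = A Γ[Y] + Γ[Y] A` produces two equal terms. Only one `Γ` remains, which makes
the metric easy to differentiate. -/
theorem metric_eq {A : SymMat n} (hA : A.mat.PosDef) (X Y : SymMat n) :
    metric A X Y = (sylvester A.mat X.mat * Y.mat).trace / 2 := by
  have h1 := (isSymm_sylvester hA X.isSymm).eq
  have h2 := (isSymm_sylvester hA Y.isSymm).eq
  have h3 := (isSymm_of_posDef hA).eq
  have e : (sylvester A.mat X.mat * Y.mat).trace
      = (sylvester A.mat X.mat * A.mat * sylvester A.mat Y.mat).trace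
        + (sylvester A.mat X.mat * sylvester A.mat Y.mat * A.mat).trace := by
    conv_lhs => rw [← sylvester_mul_add hA Y.mat]
    rw [mul_add, Matrix.trace_add, mul_assoc, mul_assoc]
  have e1 : (sylvester A.mat X.mat * A.mat * sylvester A.mat Y.mat).trace = metric A X Y := by
    rw [metric, ← Matrix.trace_transpose, Matrix.transpose_mul, Matrix.transpose_mul, h1, h2, h3,
      mul_assoc]
  have e2 : (sylvester A.mat X.mat * sylvester A.mat Y.mat * A.mat).trace = metric A X Y := by
    rw [metric, Matrix.trace_mul_comm (sylvester A.mat Y.mat * A.mat), mul_assoc]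
  rw [e, e1, e2]
  ring

theorem metric_smul (A X : SymMat n) (c : ℝ) : metric A (c • X) (c • X) = c ^ 2 * metric A X X := by
  simp only [metric, sylvester, map_smul, smul_mul_assoc, mul_smul_comm, Matrix.trace_smul,
    smul_eq_mul]
  ring

theorem metric_self {A : SymMat n} (hA : A.mat.PosDef) (X : SymMat n) :
    0 ≤ metric A X X := by
  have := (hA.posSemidef.mul_mul_conjTranspose_same (sylvester A.mat X.mat)).trace_nonneg
  rwa [Matrix.conjTranspose_eq_transpose_of_trivial, (isSymm_sylvester hA X.isSymm).eq] at this

theorem contDiffAt_inverse_apply {F E : Type*} [NormedAddCommGroup F] [NormedSpace ℝ F]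
    [NormedAddCommGroup E] [NormedSpace ℝ E] [CompleteSpace E] (L : F →L[ℝ] E →L[ℝ] E) {a : F}
    (ha : IsUnit (L a)) (x : E) (k : ℕ∞ω) :
    ContDiffAt ℝ k (fun p : F × E => Ring.inverse (L p.1) p.2) (a, x) := by
  have h1 : ContDiffAt ℝ k (fun p : F × E => Ring.inverse (L p.1)) (a, x) := by
    obtain ⟨u, hu⟩ := ha
    have h2 : ContDiffAt ℝ k Ring.inverse (L a) := by
      rw [← hu]
      exact contDiffAt_ringInverse ℝ u
    exact h2.comp (a, x) (L.contDiff.comp contDiff_fst).contDiffAt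
  exact h1.clm_apply contDiff_snd.contDiffAt

section

attribute [-instance] instTopologicalSpaceMatrix Matrix.instUniformSpace
attribute [local instance] Matrix.linftyOpNormedRing Matrix.linftyOpNormedAlgebra

/-- `Γ_A` is the inverse of the operator of left plus right multiplication by `A`, and inversion of
units is smooth in a Banach algebra. The operator norm makes matrices a normed algebra here. -/
theorem contDiffAt_sylvester {A : Matrix (Fin n) (Fin n) ℝ} (hA : A.PosDef)
    (X : Matrix (Fin n) (Fin n) ℝ) (k : ℕ∞ω) :
    ContDiffAt ℝ k (fun p : Matrix (Fin n) (Fin n) ℝ × Matrix (Fin n) (Fin n) ℝ =>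
      sylvester p.1 p.2) (A, X) := by
  let M := Matrix (Fin n) (Fin n) ℝ
  let e := Module.End.toContinuousLinearMap (𝕜 := ℝ) M
  let L : M →L[ℝ] M →L[ℝ] M := ContinuousLinearMap.mul ℝ M + (ContinuousLinearMap.mul ℝ M).flip
  have hL (B : M) : L B = e (sylvesterOp B) := by
    ext1 G
    simp [L, e]
    rfl
  have hs (B Y : M) : sylvester B Y = Ring.inverse (L B) Y := by
    rw [hL, show e (sylvesterOp B) = e.toRingEquiv (sylvesterOp B) from rfl, map_ring_inverse]
    rfl
  have hu : IsUnit (L A) := by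
    have hinj := sylvesterOp_injective hA
    have hu : IsUnit (sylvesterOp A) := by
      rw [Module.End.isUnit_iff]
      exact ⟨hinj, LinearMap.injective_iff_surjective.1 hinj⟩
    rw [hL]
    exact hu.map e
  simp only [hs]
  exact contDiffAt_inverse_apply L hu X k

/-- The inclusion `Sym(n) ⊆ M(n)` as a continuous linear map. -/
noncomputable def matL (n : ℕ) : SymMat n →L[ℝ] Matrix (Fin n) (Fin n) ℝ :=
  LinearMap.toContinuousLinearMap SymMat.mat

theorem matL_apply (X : SymMat n) : matL n X = X.mat := rfl

/-- The trace as a continuous linear map. -/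
noncomputable def traceL (n : ℕ) : Matrix (Fin n) (Fin n) ℝ →L[ℝ] ℝ :=
  LinearMap.toContinuousLinearMap (Matrix.traceLinearMap (Fin n) ℝ ℝ)

theorem traceL_apply (X : Matrix (Fin n) (Fin n) ℝ) : traceL n X = X.trace := rfl

theorem eventually_posDef {A : SymMat n} (hA : A.mat.PosDef) :
    ∀ᶠ B in nhds A, (B : SymMat n).mat.PosDef :=
  (isOpen_posDef n).mem_nhds hA

/-- Differentiate `B Γ_B[Y] + Γ_B[Y] B = Y`, which holds for all `B` near `A`. -/
theorem hasFDerivAt_sylvester {A : SymMat n} (hA : A.mat.PosDef) (Y : SymMat n) :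
    ∃ D : SymMat n →L[ℝ] Matrix (Fin n) (Fin n) ℝ,
      HasFDerivAt (fun B : SymMat n => sylvester B.mat Y.mat) D A ∧
      ∀ X, A.mat * D X + D X * A.mat
        = -(X.mat * sylvester A.mat Y.mat + sylvester A.mat Y.mat * X.mat) := by
  have h1 : DifferentiableAt ℝ (fun B : SymMat n => sylvester B.mat Y.mat) A := by
    have h2 := (contDiffAt_sylvester hA Y.mat 1).differentiableAt one_ne_zero
    exact h2.comp A ((matL n).differentiableAt.prodMk (differentiableAt_const Y.mat))
  obtain ⟨D, hD⟩ := h1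
  refine ⟨D, hD, fun X => ?_⟩
  have hm : HasFDerivAt (fun B : SymMat n => B.mat) (matL n) A := (matL n).hasFDerivAt
  have h3 := (hm.mul' hD).add (hD.mul' hm)
  have h4 := h3.unique (((hasFDerivAt_const Y.mat A).congr_of_eventuallyEq (by
    filter_upwards [eventually_posDef hA] with B hB
    exact sylvester_mul_add hB Y.mat)))
  have h5 := congrArg (fun f => f X) h4
  simp [matL_apply] at h5
  rw [eq_neg_iff_add_eq_zero, ← h5]
  abel

theorem fderiv_metric {A : SymMat n} (hA : A.mat.PosDef) (X Y Z : SymMat n) :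
    fderiv ℝ (fun B => metric B Y Z) A X
      = -((X.mat * sylvester A.mat Y.mat + sylvester A.mat Y.mat * X.mat)
          * sylvester A.mat Z.mat).trace / 2 := by
  obtain ⟨D, hD, hDX⟩ := hasFDerivAt_sylvester hA Y
  have h1 : HasFDerivAt (fun B : SymMat n => (sylvester B.mat Y.mat * Z.mat).trace / 2)
      ((1 / 2 : ℝ) • (traceL n).comp
        ((ContinuousLinearMap.mul ℝ (Matrix (Fin n) (Fin n) ℝ)).flip Z.mat ∘L D)) A := by
    have h2 := ((traceL n).hasFDerivAt.comp A
      (((ContinuousLinearMap.mul ℝ (Matrix (Fin n) (Fin n) ℝ)).flip Z.mat).hasFDerivAt.comp A hD)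
      ).const_smul (1 / 2 : ℝ)
    refine h2.congr_of_eventuallyEq (Filter.Eventually.of_forall fun B => ?_)
    simp [traceL_apply]
    ring
  have h3 := h1.congr_of_eventuallyEq (f₁ := fun B => metric B Y Z) (by
    filter_upwards [eventually_posDef hA] with B hB
    exact metric_eq hB Y Z)
  rw [h3.fderiv]
  have h4 : sylvester A.mat (-(X.mat * sylvester A.mat Y.mat + sylvester A.mat Y.mat * X.mat))
      = D X := (sylvester_eq_iff hA _ _).2 (hDX X)
  have h5 := trace_sylvester_mul hA
    (-(X.mat * sylvester A.mat Y.mat + sylvester A.mat Y.mat * X.mat)) Z.mat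
  rw [h4, neg_mul, Matrix.trace_neg] at h5
  simp [traceL_apply, h5]
  ring

end

/-! ### The geodesic equation as a matrix equation -/

theorem metric_add_christoffel {A : SymMat n} (hA : A.mat.PosDef) (V W Z : SymMat n) :
    metric A W Z + christoffel A V V Z
      = ((W.mat - 2 • (sylvester A.mat V.mat * A.mat * sylvester A.mat V.mat))
          * sylvester A.mat Z.mat).trace / 2 := by
  rw [christoffel, fderiv_metric hA, fderiv_metric hA, metric_eq hA, trace_sylvester_mul hA]
  have hV := sylvester_mul_add hA V.mat
  have hZ := sylvester_mul_add hA Z.mat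
  set G := sylvester A.mat V.mat
  set H := sylvester A.mat Z.mat
  have e : (Z.mat * G + G * Z.mat) * G = Z.mat * (G * G) + G * (Z.mat * G) := by noncomm_ring
  have e1 : (G * (Z.mat * G)).trace = (Z.mat * (G * G)).trace := by
    rw [Matrix.trace_mul_comm, mul_assoc]
  -- Writing `Z = A H + H A` leaves `H = Γ_A[Z]` as the only trace of `Z`.
  have e2 : (Z.mat * (G * G)).trace = ((G * G * A.mat + A.mat * (G * G)) * H).trace := by
    have c1 : (A.mat * H * (G * G)).trace = (G * G * A.mat * H).trace := by
      rw [Matrix.trace_mul_comm, ← mul_assoc]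
    have c2 : (H * A.mat * (G * G)).trace = (A.mat * (G * G) * H).trace := by
      rw [mul_assoc, Matrix.trace_mul_comm]
    rw [← hZ, add_mul, add_mul, Matrix.trace_add, Matrix.trace_add, c1, c2]
  have e3 : W.mat - 2 • (G * A.mat * G)
      = W.mat - (V.mat * G + G * V.mat) + (G * G * A.mat + A.mat * (G * G)) := by
    rw [← hV]; noncomm_ring
  rw [e, Matrix.trace_add, e1, e2, e3, add_mul (W.mat - _), sub_mul,
    Matrix.trace_add, Matrix.trace_sub]
  ring

theorem geodesic_equation_iff {A : SymMat n} (hA : A.mat.PosDef) (V W : SymMat n) :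
    (∀ Z, metric A W Z + christoffel A V V Z = 0) ↔
      W.mat = 2 • (sylvester A.mat V.mat * A.mat * sylvester A.mat V.mat) := by
  simp only [metric_add_christoffel hA]
  have hG := (isSymm_sylvester hA V.isSymm).eq
  set G := sylvester A.mat V.mat
  have hE : (W.mat - 2 • (G * A.mat * G)).IsSymm := by
    rw [Matrix.IsSymm]
    simp only [Matrix.transpose_sub, Matrix.transpose_smul, Matrix.transpose_mul, hG, W.isSymm.eq,
      A.isSymm.eq, mul_assoc]
  set E := W.mat - 2 • (G * A.mat * G) with hEdef
  constructor
  · intro h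
    -- Test with `Z = A E + E A`, for which `Γ_A[Z] = E`; the equation then reads `tr E² = 0`.
    have hZ : (A.mat * E + E * A.mat).IsSymm := by
      rw [Matrix.IsSymm]
      simp only [Matrix.transpose_add, Matrix.transpose_mul, hE.eq, A.isSymm.eq, add_comm]
    have h1 := h (SymMat.ofMat _ hZ)
    rw [SymMat.mat_ofMat, (sylvester_eq_iff hA _ E).2 rfl] at h1
    have h2 : (Eᵀ * E).trace = 0 := by rw [hE.eq]; linarith
    have h3 : E = 0 := by
      rwa [← Matrix.conjTranspose_eq_transpose_of_trivial,
        Matrix.trace_conjTranspose_mul_self_eq_zero_iff] at h2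
    exact sub_eq_zero.1 (hEdef ▸ h3)
  · intro h Z
    rw [hEdef, h, sub_self, zero_mul, Matrix.trace_zero, zero_div]

/-! ### Solutions of the geodesic equation -/

/-- An eigenvalue `μ ≤ 0` of `1 + t S` would make `1 + s S` singular at the earlier time `s = t / (1
- μ)`. -/
theorem posDef_one_add_smul {S : Matrix (Fin n) (Fin n) ℝ} (hS : S.IsSymm) {t : ℝ} (ht : 0 ≤ t)
    (h : ∀ s ∈ Icc 0 t, IsUnit (1 + s • S)) : (1 + t • S).PosDef := by
  have hT : (1 + t • S).IsHermitian := by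
    rw [Matrix.IsHermitian, Matrix.conjTranspose_eq_transpose_of_trivial]
    simp [hS.eq]
  rw [hT.posDef_iff_eigenvalues_pos]
  intro i
  by_contra! hi
  set μ := hT.eigenvalues i
  have hv0 : (hT.eigenvectorBasis i).ofLp ≠ 0 := by
    intro h0
    apply hT.eigenvectorBasis.orthonormal.ne_zero i
    ext j
    exact congrFun h0 j
  have hv := hT.mulVec_eigenvectorBasis i
  set v := (hT.eigenvectorBasis i).ofLp
  have hμ : 0 < 1 - μ := by linarith
  have hs : t / (1 - μ) ∈ Icc 0 t :=
    ⟨by positivity, div_le_self ht (by linarith)⟩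
  have h1 : t • (S *ᵥ v) = (μ - 1) • v := by
    rw [Matrix.add_mulVec, Matrix.one_mulVec, Matrix.smul_mulVec] at hv
    rw [sub_smul, one_smul, ← hv, add_sub_cancel_left]
  have h2 : (1 + (t / (1 - μ)) • S) *ᵥ v = 0 := by
    rw [Matrix.add_mulVec, Matrix.one_mulVec, Matrix.smul_mulVec, div_eq_inv_mul, mul_smul, h1,
      smul_smul, show (1 - μ)⁻¹ * (μ - 1) = -1 by field_simp; ring, neg_one_smul, add_neg_cancel]
  have h3 := Matrix.mulVec_injective_iff_isUnit.2 (h _ hs)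
  exact hv0 (h3 (h2.trans (Matrix.mulVec_zero _).symm))

/-- Grönwall's inequality, with `g` bounded on the compact interval; it identifies solutions of the
linear equations below. -/
theorem eq_zero_of_norm_deriv_le {E : Type*} [NormedAddCommGroup E] [NormedSpace ℝ E]
    {f f' : ℝ → E} {g : ℝ → ℝ} {b : ℝ}
    (hf : ∀ t ∈ Icc 0 b, HasDerivWithinAt f (f' t) (Icc 0 b) t) (hg : ContinuousOn g (Icc 0 b))
    (hfg : ∀ t ∈ Icc 0 b, ‖f' t‖ ≤ g t * ‖f t‖) (h0 : f 0 = 0) : ∀ t ∈ Icc 0 b, f t = 0 := by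
  obtain ⟨K, hK⟩ := isCompact_Icc.bddAbove_image hg
  refine eq_zero_of_abs_deriv_le_mul_abs_self_of_eq_zero_right (K := K) (f' := f')
    (fun t ht => (hf t ht).continuousWithinAt) (fun t ht => ?_) h0 fun t ht => ?_
  · have h1 := hf t (Ico_subset_Icc_self ht)
    have h2 : HasDerivWithinAt f (f' t) (Icc t b) t :=
      h1.mono (Icc_subset_Icc_left ht.1)
    exact h2.mono_of_mem_nhdsWithin (Icc_mem_nhdsGE ht.2)
  · have h1 := Ico_subset_Icc_self ht
    exact (hfg t h1).trans
      (mul_le_mul_of_nonneg_right (hK (mem_image_of_mem _ h1)) (norm_nonneg _))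

section

attribute [-instance] instTopologicalSpaceMatrix Matrix.instUniformSpace
attribute [local instance] Matrix.linftyOpNormedRing Matrix.linftyOpNormedAlgebra

theorem hasDerivAt_one_add_smul (S : Matrix (Fin n) (Fin n) ℝ) (t : ℝ) :
    HasDerivAt (fun t : ℝ => 1 + t • S) S t := by
  simpa using ((hasDerivAt_id t).smul_const S).const_add (1 : Matrix (Fin n) (Fin n) ℝ)

/-- The defect `f = G (1 + t G₀) - G₀` satisfies `f' = -G f` and `f 0 = 0`. Invertibility of `1 + t
G₀` is not yet known, so no inverse appears. -/
theorem riccati_solution {G : ℝ → Matrix (Fin n) (Fin n) ℝ} {b : ℝ}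
    (hG : ∀ t ∈ Icc 0 b, HasDerivWithinAt G (-(G t * G t)) (Icc 0 b) t) :
    ∀ t ∈ Icc 0 b, G t * (1 + t • G 0) = G 0 := by
  intro t ht
  rw [← sub_eq_zero]
  refine eq_zero_of_norm_deriv_le (f := fun t => G t * (1 + t • G 0) - G 0)
    (f' := fun t => -(G t) * (G t * (1 + t • G 0) - G 0)) (g := fun t => ‖G t‖)
    (fun t ht => ?_) (fun t ht => (hG t ht).continuousWithinAt.norm) (fun t ht => ?_)
    (by simp) t ht
  · have h1 := ((hG t ht).mul (hasDerivAt_one_add_smul (G 0) t).hasDerivWithinAt).sub_const (G 0)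
    refine h1.congr_deriv ?_
    noncomm_ring
  · exact (norm_mul_le _ _).trans_eq (by rw [norm_neg])

/-- By the Riccati solution and its transpose, the right side also solves `X' = X G + G X`, with the
same initial value. -/
theorem linear_flow_solution {B G : ℝ → Matrix (Fin n) (Fin n) ℝ} {b : ℝ}
    (hB : ∀ t ∈ Icc 0 b, HasDerivWithinAt B (B t * G t + G t * B t) (Icc 0 b) t)
    (hG : ∀ t ∈ Icc 0 b, HasDerivWithinAt G (-(G t * G t)) (Icc 0 b) t)
    (hs : ∀ t ∈ Icc 0 b, (G t).IsSymm) :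
    ∀ t ∈ Icc 0 b, B t = (1 + t • G 0) * B 0 * (1 + t • G 0) := by
  intro t ht
  have h0 : (0 : ℝ) ∈ Icc 0 b := ⟨le_rfl, ht.1.trans ht.2⟩
  have hT := riccati_solution hG
  have hT' : ∀ t ∈ Icc 0 b, (1 + t • G 0) * G t = G 0 := fun t ht => by
    have := congrArg Matrix.transpose (hT t ht)
    simpa [(hs t ht).eq, (hs 0 h0).eq, Matrix.transpose_mul] using this
  rw [← sub_eq_zero]
  let C : ℝ → Matrix (Fin n) (Fin n) ℝ := fun t => (1 + t • G 0) * B 0 * (1 + t • G 0)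
  refine eq_zero_of_norm_deriv_le (f := fun t => B t - C t)
    (f' := fun t => (B t - C t) * G t + G t * (B t - C t)) (g := fun t => 2 * ‖G t‖)
    (fun t ht => ?_) (fun t ht => ?_) (fun t ht => ?_)
    (by simp [C]) t ht
  · have h1 := (hasDerivAt_one_add_smul (G 0) t).hasDerivWithinAt (s := Icc 0 b)
    refine ((hB t ht).sub ((h1.mul_const (B 0)).mul h1)).congr_deriv ?_
    have e1 : C t * G t = (1 + t • G 0) * B 0 * G 0 := by
      simp only [C]; rw [mul_assoc, hT' t ht]
    have e2 : G t * C t = G 0 * B 0 * (1 + t • G 0) := by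
      simp only [C]; rw [← mul_assoc, ← mul_assoc, hT t ht]
    rw [sub_mul, mul_sub, e1, e2]
    abel
  · exact continuousWithinAt_const.mul (hG t ht).continuousWithinAt.norm
  · refine (norm_add_le _ _).trans ?_
    have h1 := norm_mul_le (B t - C t) (G t)
    have h2 := norm_mul_le (G t) (B t - C t)
    linarith

theorem hasDerivWithinAt_mat {c : ℝ → SymMat n} {V : SymMat n} {I : Set ℝ} {t : ℝ}
    (h : HasDerivWithinAt c V I t) : HasDerivWithinAt (fun t => (c t).mat) V.mat I t :=
  (matL n).hasFDerivAt.comp_hasDerivWithinAt t h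

theorem differentiableWithinAt_sylvester {B V : ℝ → Matrix (Fin n) (Fin n) ℝ} {I : Set ℝ} {t : ℝ}
    (hB : DifferentiableWithinAt ℝ B I t) (hV : DifferentiableWithinAt ℝ V I t)
    (hp : (B t).PosDef) : DifferentiableWithinAt ℝ (fun t => sylvester (B t) (V t)) I t :=
  ((contDiffAt_sylvester hp (V t) 1).differentiableAt one_ne_zero).comp_differentiableWithinAt
    (f := fun t => (B t, V t)) t (hB.prodMk hV)

theorem SPD.posDef (A : SPD n) : A.mat.PosDef := A.2

/-- Differentiating `V = B G + G B` and inserting the geodesic equation `V' = 2 G B G` leaves `B G'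
+ G' B = -(B G² + G² B)`; uniqueness for the Sylvester equation gives `G' = -G²`. -/
theorem IsGeodesicOn.hasDerivWithinAt_sylvester {γ : ℝ → SPD n} {I : Set ℝ}
    (hγ : IsGeodesicOn γ I) (hI : UniqueDiffOn ℝ I) {t : ℝ} (ht : t ∈ I) :
    HasDerivWithinAt (fun t => sylvester (curve γ t).mat (derivWithin (curve γ) I t).mat)
      (-(sylvester (curve γ t).mat (derivWithin (curve γ) I t).mat
        * sylvester (curve γ t).mat (derivWithin (curve γ) I t).mat)) I t := by
  have hc := hγ.1
  have hB : HasDerivWithinAt (curve γ) (derivWithin (curve γ) I t) I t :=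
    (hc.differentiableOn two_ne_zero t ht).hasDerivWithinAt
  have hV : HasDerivWithinAt (derivWithin (curve γ) I)
      (derivWithin (derivWithin (curve γ) I) I t) I t :=
    ((hc.derivWithin hI (m := 1) (by norm_num)).differentiableOn one_ne_zero t
      ht).hasDerivWithinAt
  have hp : ∀ s, (curve γ s).mat.PosDef := fun s => (γ s).posDef
  have hW := (geodesic_equation_iff (hp t) _ _).1 (hγ.2 t ht)
  have hBm := hasDerivWithinAt_mat hB
  have hVm := hasDerivWithinAt_mat hV
  have hG := (differentiableWithinAt_sylvester hBm.differentiableWithinAt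
    hVm.differentiableWithinAt (hp t)).hasDerivWithinAt
  refine hG.congr_deriv ?_
  set D := derivWithin (fun t => sylvester (curve γ t).mat (derivWithin (curve γ) I t).mat) I t
  have h1 := ((hBm.mul hG).add (hG.mul hBm)).congr_of_eventuallyEq (f₁ := fun t =>
    (derivWithin (curve γ) I t).mat) (Filter.Eventually.of_forall fun s =>
      (sylvester_mul_add (hp s) _).symm) (sylvester_mul_add (hp t) _).symm
  have h2 := (hI t ht).eq_deriv _ h1 hVm
  have hVe := sylvester_mul_add (hp t) (derivWithin (curve γ) I t).mat
  rw [hW] at h2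
  set G := sylvester (curve γ t).mat (derivWithin (curve γ) I t).mat
  rw [← hVe] at h2
  set B := (curve γ t).mat
  have h3 : B * D + D * B = B * (-(G * G)) + (-(G * G)) * B := by
    have e : B * D + D * B = ((B * G + G * B) * G + B * D + (D * B + G * (B * G + G * B)))
        - ((B * G + G * B) * G + G * (B * G + G * B)) := by abel
    rw [e, h2]
    noncomm_ring
  have h4 := (sylvester_eq_iff (hp t) _ D).2 h3
  rw [← h4, (sylvester_eq_iff (hp t) _ _).2 rfl]

end

theorem isUnit_of_posDef_mul_mul {T A B : Matrix (Fin n) (Fin n) ℝ} (h : T * A * T = B)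
    (hB : B.PosDef) : IsUnit T := by
  have := hB.isUnit
  rw [← h] at this
  exact isUnit_of_mul_isUnit_right this

theorem isSymm_one_add_smul {S : Matrix (Fin n) (Fin n) ℝ} (hS : S.IsSymm) (t : ℝ) :
    (1 + t • S).IsSymm := by
  rw [Matrix.IsSymm]
  simp [hS.eq]

section

attribute [-instance] instTopologicalSpaceMatrix Matrix.instUniformSpace
attribute [local instance] Matrix.linftyOpNormedRing Matrix.linftyOpNormedAlgebra

/-- The curve is positive definite, so all `1 + s G₀` with `s ≤ t` are invertible, which forces
positivity of `1 + t G₀`. The speed is constant because `G(t) (1 + t G₀) = G₀`. -/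
theorem IsGeodesicOn.eq_flow {γ : ℝ → SPD n} {I : Set ℝ} (hγ : IsGeodesicOn γ I)
    (hI : UniqueDiffOn ℝ I) {b : ℝ} (hb : Icc 0 b ⊆ I) {G₀ : Matrix (Fin n) (Fin n) ℝ}
    (hG₀ : G₀ = sylvester (γ 0).mat (derivWithin (curve γ) I 0).mat) {t : ℝ}
    (ht : t ∈ Icc 0 b) :
    (1 + t • G₀).PosDef ∧ (γ t).mat = (1 + t • G₀) * (γ 0).mat * (1 + t • G₀) ∧
      metric (curve γ t) (derivWithin (curve γ) I t) (derivWithin (curve γ) I t)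
        = (G₀ * (γ 0).mat * G₀).trace := by
  let B : ℝ → Matrix (Fin n) (Fin n) ℝ := fun t => (curve γ t).mat
  let G : ℝ → Matrix (Fin n) (Fin n) ℝ :=
    fun t => sylvester (B t) (derivWithin (curve γ) I t).mat
  have h0 : (0 : ℝ) ∈ Icc 0 b := ⟨le_rfl, ht.1.trans ht.2⟩
  have hp : ∀ s, (B s).PosDef := fun s => (γ s).posDef
  have hs : ∀ s ∈ Icc 0 b, (G s).IsSymm := fun s _ => isSymm_sylvester (hp s) (SymMat.isSymm _)
  have hG := fun s (h : s ∈ Icc 0 b) => (hγ.hasDerivWithinAt_sylvester hI (hb h)).mono hb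
  have hB : ∀ s ∈ Icc 0 b, HasDerivWithinAt B (B s * G s + G s * B s) (Icc 0 b) s := fun s h =>
    ((hasDerivWithinAt_mat (hγ.1.differentiableOn two_ne_zero s (hb h)).hasDerivWithinAt).mono
      hb).congr_deriv (sylvester_mul_add (hp s) _).symm
  have hflow := linear_flow_solution (B := B) (G := G) hB hG hs
  have hric := riccati_solution (G := G) hG
  have e0 : G 0 = G₀ := hG₀.symm
  have eB : ∀ s, B s = (γ s).mat := fun s => rfl
  rw [e0] at hflow hric
  refine ⟨posDef_one_add_smul (e0 ▸ hs 0 h0) ht.1 fun s hst => ?_, hflow t ht, ?_⟩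
  · exact isUnit_of_posDef_mul_mul (hflow s ⟨hst.1, hst.2.trans ht.2⟩).symm (hp s)
  · change (G t * B t * G t).trace = _
    have h1 := hric t ht
    have h2 := congrArg Matrix.transpose h1
    rw [Matrix.transpose_mul, (hs t ht).eq, (e0 ▸ hs 0 h0 : G₀.IsSymm).eq,
      (isSymm_one_add_smul (e0 ▸ hs 0 h0) t).eq] at h2
    rw [hflow t ht, ← eB 0]
    calc _ = (G t * (1 + t • G₀) * B 0 * ((1 + t • G₀) * G t)).trace := by
          congr 1; noncomm_ring
      _ = _ := by rw [h1, h2]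

end

/-- The geodesic with initial point `A` and initial velocity `A G + G A`, in `Sym(n)`. -/
noncomputable def symFlow (A : SPD n) (G : SymMat n) (t : ℝ) : SymMat n :=
  A.sym + t • SymMat.ofMat (A.mat * G.mat + G.mat * A.mat) (by
      rw [Matrix.IsSymm, Matrix.transpose_add, Matrix.transpose_mul, Matrix.transpose_mul,
        G.isSymm.eq, (isSymm_of_posDef A.posDef).eq, add_comm])
    + t ^ 2 • SymMat.ofMat (G.mat * A.mat * G.mat) (by
      rw [Matrix.IsSymm, Matrix.transpose_mul, Matrix.transpose_mul, G.isSymm.eq,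
        (isSymm_of_posDef A.posDef).eq, mul_assoc])

theorem mat_symFlow (A : SPD n) (G : SymMat n) (t : ℝ) :
    (symFlow A G t).mat = (1 + t • G.mat) * A.mat * (1 + t • G.mat) := by
  simp only [symFlow, map_add, map_smul, SymMat.mat_ofMat, add_mul, mul_add, one_mul, mul_one,
    smul_mul_assoc, mul_smul_comm, smul_add, smul_smul, pow_two]
  change A.mat + _ + _ = _
  abel

theorem posDef_one_add_smul_sub_one {T : Matrix (Fin n) (Fin n) ℝ} (hT : T.PosDef) {t : ℝ}
    (ht : t ∈ Icc (0 : ℝ) 1) : (1 + t • (T - 1)).PosDef := by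
  have e : 1 + t • (T - 1) = (1 - t) • (1 : Matrix (Fin n) (Fin n) ℝ) + t • T := by module
  rw [e]
  rcases ht.2.eq_or_lt with rfl | h1
  · simpa using hT
  · exact (Matrix.PosDef.one.smul (sub_pos.2 h1)).add_posSemidef (hT.posSemidef.smul ht.1)

theorem exists_geodesic (A : SPD n) {T : Matrix (Fin n) (Fin n) ℝ} (hT : T.PosDef) :
    ∃ γ : ℝ → SPD n, IsGeodesicOn γ (Icc 0 1) ∧ γ 0 = A ∧ (γ 1).mat = T * A.mat * T := by
  classical
  have hTs := isSymm_of_posDef hT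
  let G : SymMat n := SymMat.ofMat (T - 1) (by rw [Matrix.IsSymm]; simp [hTs.eq])
  have hpT : ∀ t ∈ Icc (0 : ℝ) 1, (1 + t • G.mat).PosDef :=
    fun t ht => posDef_one_add_smul_sub_one hT ht
  have hp : ∀ t ∈ Icc (0 : ℝ) 1, (symFlow A G t).mat.PosDef := by
    intro t ht
    rw [mat_symFlow]
    exact posDef_mul_mul A.posDef (hpT t ht)
  -- Outside `[0, 1]` the flow may leave `SPD(n)`; there the value `A` is irrelevant.
  let γ : ℝ → SPD n := fun t => if h : (symFlow A G t).mat.PosDef then ⟨symFlow A G t, h⟩ else A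
  have hγ : ∀ t ∈ Icc (0 : ℝ) 1, curve γ t = symFlow A G t := by
    intro t ht
    simp only [curve, γ, dif_pos (hp t ht)]
    rfl
  set X₁ : SymMat n := SymMat.ofMat (A.mat * G.mat + G.mat * A.mat) (by
      rw [Matrix.IsSymm, Matrix.transpose_add, Matrix.transpose_mul, Matrix.transpose_mul,
        G.isSymm.eq, (isSymm_of_posDef A.posDef).eq, add_comm]) with hX₁
  set X₂ : SymMat n := SymMat.ofMat (G.mat * A.mat * G.mat) (by
      rw [Matrix.IsSymm, Matrix.transpose_mul, Matrix.transpose_mul, G.isSymm.eq,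
        (isSymm_of_posDef A.posDef).eq, mul_assoc]) with hX₂
  have hd : ∀ t : ℝ, HasDerivAt (symFlow A G) (X₁ + (2 * t) • X₂) t := by
    intro t
    have h1 := (((hasDerivAt_id t).smul_const X₁).const_add A.sym).add
      ((hasDerivAt_pow 2 t).smul_const X₂)
    refine h1.congr_deriv ?_
    simp
  have hd' : ∀ t : ℝ, HasDerivAt (fun t : ℝ => X₁ + (2 * t) • X₂) ((2 : ℝ) • X₂) t := by
    intro t
    have h1 := (((hasDerivAt_id t).const_mul (2 : ℝ)).smul_const X₂).const_add X₁
    refine h1.congr_deriv ?_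
    simp
  have hI := uniqueDiffOn_Icc (zero_lt_one (α := ℝ))
  have hV : ∀ t ∈ Icc (0 : ℝ) 1, derivWithin (curve γ) (Icc 0 1) t = X₁ + (2 * t) • X₂ := by
    intro t ht
    exact ((hd t).hasDerivWithinAt.congr hγ (hγ t ht)).derivWithin (hI t ht)
  have hW : ∀ t ∈ Icc (0 : ℝ) 1,
      derivWithin (derivWithin (curve γ) (Icc 0 1)) (Icc 0 1) t = (2 : ℝ) • X₂ := by
    intro t ht
    exact ((hd' t).hasDerivWithinAt.congr hV (hV t ht)).derivWithin (hI t ht)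
  refine ⟨γ, ⟨?_, fun t ht => ?_⟩, ?_, ?_⟩
  · have : ContDiff ℝ 2 (symFlow A G) := by
      unfold symFlow
      fun_prop
    exact this.contDiffOn.congr hγ
  · rw [hV t ht, hW t ht, hγ t ht, geodesic_equation_iff (hp t ht)]
    have hu : IsUnit (1 + t • G.mat).det :=
      (Matrix.isUnit_iff_isUnit_det _).1 (hpT t ht).isUnit
    have hc : (1 + t • G.mat) * G.mat = G.mat * (1 + t • G.mat) := by
      simp [add_mul, mul_add]
    have hc' : (1 + t • G.mat)⁻¹ * G.mat = G.mat * (1 + t • G.mat)⁻¹ := by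
      calc _ = (1 + t • G.mat)⁻¹ * (G.mat * (1 + t • G.mat)) * (1 + t • G.mat)⁻¹ := by
            rw [mul_assoc, mul_assoc, Matrix.mul_nonsing_inv _ hu, mul_one]
        _ = _ := by
            rw [← hc, ← mul_assoc, Matrix.nonsing_inv_mul _ hu, one_mul]
    -- This is the Riccati solution with initial value `G`; it commutes with `1 + t G`.
    have hs : sylvester (symFlow A G t).mat (X₁ + (2 * t) • X₂).mat
        = G.mat * (1 + t • G.mat)⁻¹ := by
      rw [sylvester_eq_iff (hp t ht), mat_symFlow]
      nth_rewrite 1 [← hc']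
      calc _ = (1 + t • G.mat) * A.mat * ((1 + t • G.mat) * (1 + t • G.mat)⁻¹) * G.mat
            + G.mat * ((1 + t • G.mat)⁻¹ * (1 + t • G.mat)) * A.mat * (1 + t • G.mat) := by
              simp only [mul_assoc]
        _ = (1 + t • G.mat) * A.mat * G.mat + G.mat * A.mat * (1 + t • G.mat) := by
              rw [Matrix.nonsing_inv_mul _ hu, Matrix.mul_nonsing_inv _ hu, mul_one, mul_one]
        _ = _ := by
              simp only [map_add, map_smul, hX₁, hX₂, SymMat.mat_ofMat, add_mul, mul_add, one_mul,
                mul_one, smul_mul_assoc, mul_smul_comm]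
              module
    rw [hs, mat_symFlow]
    nth_rewrite 2 [← hc']
    calc _ = (2 : ℝ) • (G.mat * A.mat * G.mat) := rfl
      _ = 2 • (G.mat * ((1 + t • G.mat)⁻¹ * (1 + t • G.mat)) * A.mat
          * ((1 + t • G.mat) * (1 + t • G.mat)⁻¹) * G.mat) := by
            rw [Matrix.nonsing_inv_mul _ hu, Matrix.mul_nonsing_inv _ hu, mul_one, mul_one]
            module
      _ = _ := by simp only [mul_assoc]
  · apply Subtype.ext
    have h1 := hγ 0 ⟨le_rfl, zero_le_one⟩
    have h2 : symFlow A G 0 = A.sym := by simp [symFlow]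
    exact h1.trans h2
  · have h1 := hγ 1 ⟨zero_le_one, le_rfl⟩
    change (curve γ 1).mat = _
    rw [h1, mat_symFlow]
    simp [G]

/-! ### Curves in the open submanifold `SPD(n)` -/

theorem contMDiffOn_iff_curve {γ : ℝ → SPD n} {s : Set ℝ} {k : ℕ∞ω} :
    ContMDiffOn 𝓘(ℝ, ℝ) 𝓘(ℝ, SymMat n) k γ s ↔ ContDiffOn ℝ k (curve γ) s := by
  rw [← contMDiffOn_iff_contDiffOn]
  exact forall₂_congr fun x _ =>
    (ChartedSpace.liftPropWithinAt_subtypeVal_comp_iff (U := spdOpens n) γ s x).symm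

theorem mfderiv_eq_deriv_curve {γ : ℝ → SPD n} {t : ℝ} (h : DifferentiableAt ℝ (curve γ) t) :
    (show SymMat n from mfderiv 𝓘(ℝ, ℝ) 𝓘(ℝ, SymMat n) γ t (1 : ℝ)) = deriv (curve γ) t := by
  have hc : ContinuousAt γ t :=
    Topology.IsEmbedding.subtypeVal.isInducing.continuousAt_iff.2 h.continuousAt
  have hm : MDifferentiableAt 𝓘(ℝ, ℝ) 𝓘(ℝ, SymMat n) γ t := by
    rw [mdifferentiableAt_iff]
    refine ⟨hc, ?_⟩
    exact h.differentiableWithinAt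
  have h1 : fderivWithin ℝ (curve γ) (range id) t (1 : ℝ) = deriv (curve γ) t := by
    rw [range_id, fderivWithin_univ]
    rfl
  exact (congrArg (fun L => (show SymMat n from L (1 : ℝ))) hm.mfderiv).trans h1

theorem pathELength_eq {γ : ℝ → SPD n} {b : ℝ} {V : ℝ → SymMat n}
    (h : ∀ t ∈ Ioo 0 b, HasDerivWithinAt (curve γ) (V t) (Icc 0 b) t) :
    pathELength 𝓘(ℝ, SymMat n) γ 0 b
      = ∫⁻ t in Icc 0 b, ENNReal.ofReal (Real.sqrt (metric (curve γ t) (V t) (V t))) := by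
  rw [pathELength_eq_lintegral_mfderiv_Ioo, ← MeasureTheory.restrict_Ioo_eq_restrict_Icc]
  refine MeasureTheory.setLIntegral_congr_fun measurableSet_Ioo fun t ht => ?_
  have h1 : HasDerivAt (curve γ) (V t) t := (h t ht).hasDerivAt (Icc_mem_nhds ht.1 ht.2)
  have h2 := (mfderiv_eq_deriv_curve h1.differentiableAt).trans h1.deriv
  change ENNReal.ofReal (Real.sqrt (metric (γ t).sym
    (show SymMat n from mfderiv 𝓘(ℝ, ℝ) 𝓘(ℝ, SymMat n) γ t (1 : ℝ))
    (show SymMat n from mfderiv 𝓘(ℝ, ℝ) 𝓘(ℝ, SymMat n) γ t (1 : ℝ)))) = _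
  rw [h2]
  rfl

instance (A : SPD n) : ENormSMulClass ℝ (TangentSpace 𝓘(ℝ, SymMat n) A) where
  enorm_smul c X := by
    change ENNReal.ofReal (Real.sqrt (metric A.sym (c • (show SymMat n from X))
      (c • (show SymMat n from X)))) = ‖c‖ₑ * ENNReal.ofReal (Real.sqrt (metric A.sym _ _))
    rw [metric_smul, Real.sqrt_mul (sq_nonneg c), Real.sqrt_sq_eq_abs,
      ENNReal.ofReal_mul (abs_nonneg c), ← Real.norm_eq_abs, ofReal_norm]

theorem IsGeodesicOn.pathELength_eq {γ : ℝ → SPD n} {I : Set ℝ} (hγ : IsGeodesicOn γ I)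
    (hI : UniqueDiffOn ℝ I) {b : ℝ} (hb : Icc 0 b ⊆ I) (h0 : 0 ≤ b)
    {G₀ : Matrix (Fin n) (Fin n) ℝ}
    (hG₀ : G₀ = sylvester (γ 0).mat (derivWithin (curve γ) I 0).mat) :
    pathELength 𝓘(ℝ, SymMat n) γ 0 b
      = ENNReal.ofReal (b * Real.sqrt (G₀ * (γ 0).mat * G₀).trace) := by
  rw [BuresWasserstein.pathELength_eq (V := derivWithin (curve γ) I) fun t ht =>
    (hγ.1.differentiableOn two_ne_zero t (hb (Ioo_subset_Icc_self ht))).hasDerivWithinAt.mono hb]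
  rw [MeasureTheory.setLIntegral_congr_fun measurableSet_Icc fun t ht => by
    rw [(hγ.eq_flow hI hb hG₀ ht).2.2]]
  rw [MeasureTheory.setLIntegral_const, Real.volume_Icc, sub_zero, mul_comm,
    ENNReal.ofReal_mul h0]

/-! ### The lower bound for the length of curves -/

section

attribute [-instance] instTopologicalSpaceMatrix Matrix.instUniformSpace
attribute [local instance] Matrix.linftyOpNormedRing Matrix.linftyOpNormedAlgebra

theorem hasDerivAt_mul_inv_one_add_smul {S : Matrix (Fin n) (Fin n) ℝ} {s : ℝ}
    (h : IsUnit (1 + s • S)) :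
    HasDerivAt (fun s : ℝ => S * (1 + s • S)⁻¹)
      (-(S * (1 + s • S)⁻¹ * (S * (1 + s • S)⁻¹))) s := by
  simp only [Matrix.nonsing_inv_eq_ringInverse]
  obtain ⟨u, hu⟩ := h
  have h1 := hasFDerivAt_ringInverse (𝕜 := ℝ) u
  have hu' : (↑u⁻¹ : Matrix (Fin n) (Fin n) ℝ) = Ring.inverse (1 + s • S) := by
    rw [← hu, Ring.inverse_unit]
  rw [hu', hu] at h1
  have h2 := (h1.comp_hasDerivAt s (hasDerivAt_one_add_smul S s)).const_mul S
  refine h2.congr_deriv ?_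
  simp [mul_assoc]

theorem continuousOn_metric {c V : ℝ → SymMat n} {I : Set ℝ} (hc : ContinuousOn c I)
    (hV : ContinuousOn V I) (hp : ∀ t, (c t).mat.PosDef) :
    ContinuousOn (fun t => metric (c t) (V t) (V t)) I := by
  have h1 : ContinuousOn (fun t => (c t).mat) I := (matL n).continuous.comp_continuousOn hc
  have h2 : ContinuousOn (fun t => (V t).mat) I := (matL n).continuous.comp_continuousOn hV
  have hG : ContinuousOn (fun t => sylvester (c t).mat (V t).mat) I := fun t ht =>
    (contDiffAt_sylvester (hp t) (V t).mat 1).continuousAt.comp_continuousWithinAt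
      (f := fun t => ((c t).mat, (V t).mat)) ((h1 t ht).prodMk (h2 t ht))
  exact (traceL n).continuous.comp_continuousOn ((hG.mul h1).mul hG)

/-- The calibration inequality for the time-dependent function `B ↦ tr(P B)`. -/
theorem calibration_le {B V P : Matrix (Fin n) (Fin n) ℝ} (hB : B.PosDef) (hV : V.IsSymm)
    (hP : P.IsSymm) {σ : ℝ} (hσ : 0 < σ) :
    (σ • (-(P * P)) * B + P * V).trace ≤ (sylvester B V * B * sylvester B V).trace / σ := by
  have hG := (isSymm_sylvester hB hV).eq
  have hVe := sylvester_mul_add hB V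
  have hBs := (isSymm_of_posDef hB).eq
  set G := sylvester B V
  -- Completing the square: with `tr(P V) = 2 tr(P B G)`, this nonnegativity is the claim multiplied
  -- by `σ`.
  have h0 := (hB.posSemidef.mul_mul_conjTranspose_same (σ • P - G)).trace_nonneg
  rw [Matrix.conjTranspose_eq_transpose_of_trivial, Matrix.transpose_sub, Matrix.transpose_smul,
    hP.eq, hG] at h0
  have e1 : (G * B * P).trace = (P * B * G).trace := by
    rw [← Matrix.trace_transpose, Matrix.transpose_mul, Matrix.transpose_mul, hP.eq, hG, hBs,
      mul_assoc]
  have e2 : (P * P * B).trace = (P * B * P).trace := by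
    rw [mul_assoc, Matrix.trace_mul_comm]
  have e3 : (P * V).trace = 2 * (P * B * G).trace := by
    rw [← hVe, mul_add, Matrix.trace_add, ← mul_assoc, ← mul_assoc,
      Matrix.trace_mul_comm (P * G), ← mul_assoc,
      Matrix.trace_mul_comm (B * P) G, ← mul_assoc, e1, two_mul]
  have e : (σ • P - G) * B * (σ • P - G)
      = (σ * σ) • (P * B * P) - σ • (P * B * G) - σ • (G * B * P) + G * B * G := by
    simp only [sub_mul, mul_sub, smul_mul_assoc, mul_smul_comm]
    module
  rw [e, Matrix.trace_add, Matrix.trace_sub, Matrix.trace_sub, Matrix.trace_smul,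
    Matrix.trace_smul, Matrix.trace_smul, e1] at h0
  simp only [smul_eq_mul] at h0
  rw [le_div_iff₀ hσ, Matrix.trace_add, smul_mul_assoc, Matrix.trace_smul, neg_mul,
    Matrix.trace_neg, e2, e3, smul_eq_mul]
  nlinarith

/-- Integrate the calibration inequality along the curve; the left side is the total change of
`tr(P_s B)` as `s` runs from 0 to 1. -/
theorem trace_le_sq_length {c V : ℝ → SymMat n} {v : ℝ → ℝ} (hv : Continuous v)
    (hv0 : ∀ t, 0 ≤ v t) (hp : ∀ t, (c t).mat.PosDef)
    (hc : ∀ t ∈ Icc (0 : ℝ) 1, HasDerivWithinAt c (V t) (Icc 0 1) t)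
    (hvm : ∀ t ∈ Icc (0 : ℝ) 1, metric (c t) (V t) (V t) = v t ^ 2)
    {T : Matrix (Fin n) (Fin n) ℝ} (hT : T.PosDef) (h1 : (c 1).mat = T * (c 0).mat * T)
    {ε : ℝ} (hε : 0 < ε) :
    ((T - 1) * (c 0).mat * (T - 1)).trace
      ≤ ((∫ t in (0 : ℝ)..1, v t) + ε) * ∫ t in (0 : ℝ)..1, v t := by
  let F : ℝ → ℝ := fun t => ∫ r in (0 : ℝ)..t, v r
  have hF : ∀ t, HasDerivAt F (v t) t := fun t => hv.integral_hasStrictDerivAt 0 t |>.hasDerivAt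
  have hF0 : F 0 = 0 := intervalIntegral.integral_same
  have hFm : Monotone F := monotone_of_hasDerivAt_nonneg hF hv0
  have hL : 0 ≤ F 1 := hF0 ▸ hFm zero_le_one
  change _ ≤ (F 1 + ε) * F 1
  have hLε : 0 < F 1 + ε := by positivity
  -- Normalized arc length, perturbed by `ε` so that `s' > 0` even where the speed `v` vanishes.
  let s : ℝ → ℝ := fun t => (F t + ε * t) / (F 1 + ε)
  have hs : ∀ t, HasDerivAt s ((v t + ε) / (F 1 + ε)) t := fun t => by
    have := ((hF t).add ((hasDerivAt_id t).const_mul ε)).div_const (F 1 + ε)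
    simpa using this
  have hsI : ∀ t ∈ Icc (0 : ℝ) 1, s t ∈ Icc (0 : ℝ) 1 := by
    intro t ht
    have h2 : 0 ≤ F t := hF0 ▸ hFm ht.1
    have h3 : F t ≤ F 1 := hFm ht.2
    refine ⟨div_nonneg (add_nonneg h2 (mul_nonneg hε.le ht.1)) hLε.le, (div_le_one hLε).2 ?_⟩
    nlinarith [ht.2]
  set S := T - 1 with hS
  have hSs : S.IsSymm := by rw [Matrix.IsSymm, hS]; simp [(isSymm_of_posDef hT).eq]
  let P : ℝ → Matrix (Fin n) (Fin n) ℝ := fun r => S * (1 + r • S)⁻¹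
  have hPu : ∀ r ∈ Icc (0 : ℝ) 1, IsUnit (1 + r • S) := fun r hr =>
    (posDef_one_add_smul_sub_one hT hr).isUnit
  have hPs : ∀ r ∈ Icc (0 : ℝ) 1, (P r).IsSymm := by
    intro r hr
    have hu : IsUnit (1 + r • S).det := (Matrix.isUnit_iff_isUnit_det _).1 (hPu r hr)
    rw [Matrix.IsSymm, Matrix.transpose_mul, Matrix.transpose_nonsing_inv,
      (isSymm_one_add_smul hSs r).eq, hSs.eq]
    calc _ = (1 + r • S)⁻¹ * (S * (1 + r • S)) * (1 + r • S)⁻¹ := by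
          rw [mul_assoc, mul_assoc, Matrix.mul_nonsing_inv _ hu, mul_one]
      _ = (1 + r • S)⁻¹ * ((1 + r • S) * S) * (1 + r • S)⁻¹ := by
          simp [add_mul, mul_add]
      _ = _ := by rw [← mul_assoc, Matrix.nonsing_inv_mul _ hu, one_mul]
  let φ : ℝ → ℝ := fun t => (P (s t) * (c t).mat).trace
  let φ' : ℝ → ℝ := fun t => ((((v t + ε) / (F 1 + ε)) • (-(P (s t) * P (s t)))) * (c t).mat
    + P (s t) * (V t).mat).trace
  have hφ : ∀ t ∈ Icc (0 : ℝ) 1, HasDerivWithinAt φ (φ' t) (Icc 0 1) t := by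
    intro t ht
    have h2 : HasDerivAt (fun t => P (s t))
        (((v t + ε) / (F 1 + ε)) • (-(P (s t) * P (s t)))) t :=
      (hasDerivAt_mul_inv_one_add_smul (hPu _ (hsI t ht))).scomp t (hs t)
    exact (traceL n).hasFDerivAt.comp_hasDerivWithinAt t
      (h2.hasDerivWithinAt.mul (hasDerivWithinAt_mat (hc t ht)))
  have hφle : ∀ t ∈ Icc (0 : ℝ) 1, φ' t ≤ (F 1 + ε) * v t := by
    intro t ht
    have hvε : 0 < v t + ε := add_pos_of_nonneg_of_pos (hv0 t) hε
    refine (calibration_le (hp t) (V t).isSymm (hPs _ (hsI t ht)) (by positivity)).trans ?_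
    -- `v² / s' = (F 1 + ε) v² / (v + ε)`, and `v² / (v + ε) ≤ v`.
    have h2 : metric (c t) (V t) (V t) / ((v t + ε) / (F 1 + ε)) ≤ (F 1 + ε) * v t := by
      rw [hvm t ht, div_div_eq_mul_div, div_le_iff₀ hvε]
      nlinarith [mul_nonneg (mul_nonneg hLε.le (hv0 t)) hε.le]
    exact h2
  have hψ : AntitoneOn (fun t => φ t - (F 1 + ε) * F t) (Icc 0 1) := by
    have hd : ∀ t ∈ Icc (0 : ℝ) 1, HasDerivWithinAt (fun t => φ t - (F 1 + ε) * F t)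
        (φ' t - (F 1 + ε) * v t) (Icc 0 1) t := fun t ht =>
      (hφ t ht).sub ((hF t).const_mul (F 1 + ε)).hasDerivWithinAt
    refine antitoneOn_of_hasDerivWithinAt_nonpos (convex_Icc 0 1)
      (fun t ht => (hd t ht).continuousWithinAt)
      (fun t ht => (hd t (interior_subset ht)).mono interior_subset)
      (fun t ht => sub_nonpos.2 (hφle t (interior_subset ht)))
  have h2 := hψ (left_mem_Icc.2 zero_le_one) (right_mem_Icc.2 zero_le_one) zero_le_one
  have hs0 : s 0 = 0 := by simp [s, hF0]
  have hs1 : s 1 = 1 := by simp [s, hLε.ne']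
  have hT1 : 1 + (1 : ℝ) • S = T := by simp [hS]
  have hu : IsUnit T.det := (Matrix.isUnit_iff_isUnit_det _).1 hT.isUnit
  have e0 : φ 0 = (S * (c 0).mat).trace := by simp [φ, hs0, P]
  have e1 : φ 1 = (S * (c 0).mat * T).trace := by
    simp only [φ, hs1, P, hT1, h1]
    congr 1
    calc _ = S * (T⁻¹ * T) * (c 0).mat * T := by simp only [mul_assoc]
      _ = _ := by rw [Matrix.nonsing_inv_mul _ hu, mul_one]
  simp only [e0, e1, hF0] at h2
  have e2 : (S * (c 0).mat * S).trace = (S * (c 0).mat * T).trace - (S * (c 0).mat).trace := by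
    rw [← Matrix.trace_sub, ← mul_sub_one]
  linarith

end

theorem le_pathELength {γ : ℝ → SPD n} (hγ : ContDiffOn ℝ 1 (curve γ) (Icc 0 1))
    {T : Matrix (Fin n) (Fin n) ℝ} (hT : T.PosDef) (h1 : (γ 1).mat = T * (γ 0).mat * T) :
    ENNReal.ofReal (Real.sqrt ((T - 1) * (γ 0).mat * (T - 1)).trace)
      ≤ pathELength 𝓘(ℝ, SymMat n) γ 0 1 := by
  have hI := uniqueDiffOn_Icc (zero_lt_one (α := ℝ))
  have hc : ∀ t ∈ Icc (0 : ℝ) 1, HasDerivWithinAt (curve γ)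
      (derivWithin (curve γ) (Icc 0 1) t) (Icc 0 1) t := fun t ht =>
    (hγ.differentiableOn one_ne_zero t ht).hasDerivWithinAt
  have hp : ∀ t, (curve γ t).mat.PosDef := fun t => (γ t).posDef
  have hV : ContinuousOn (derivWithin (curve γ) (Icc 0 1)) (Icc 0 1) :=
    hγ.continuousOn_derivWithin hI le_rfl
  set V := derivWithin (curve γ) (Icc 0 1)
  have hm := (continuousOn_metric hγ.continuousOn hV hp).sqrt
  -- Extending the speed continuously to `ℝ` lets its primitive be differentiated everywhere.
  let v : ℝ → ℝ := IccExtend (zero_le_one (α := ℝ))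
    ((Icc 0 1).domRestrict fun t => Real.sqrt (metric (curve γ t) (V t) (V t)))
  have hv : Continuous v := (continuousOn_iff_continuous_domRestrict.1 hm).Icc_extend'
  have hve : ∀ t ∈ Icc (0 : ℝ) 1, v t = Real.sqrt (metric (curve γ t) (V t) (V t)) :=
    fun t ht => IccExtend_of_mem _ _ ht
  have hv0 : ∀ t, 0 ≤ v t := fun t => Real.sqrt_nonneg _
  have hL : pathELength 𝓘(ℝ, SymMat n) γ 0 1 = ENNReal.ofReal (∫ t in (0 : ℝ)..1, v t) := by
    rw [pathELength_eq (V := V) fun t ht => hc t (Ioo_subset_Icc_self ht),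
      MeasureTheory.setLIntegral_congr_fun measurableSet_Icc fun t ht => by rw [← hve t ht],
      intervalIntegral.integral_of_le zero_le_one, ← MeasureTheory.integral_Icc_eq_integral_Ioc,
      MeasureTheory.ofReal_integral_eq_lintegral_ofReal hv.integrableOn_Icc
        (Filter.Eventually.of_forall hv0)]
  rw [hL]
  refine ENNReal.ofReal_le_ofReal (Real.sqrt_le_iff.2 ?_)
  have hL0 : 0 ≤ ∫ t in (0 : ℝ)..1, v t :=
    intervalIntegral.integral_nonneg zero_le_one fun t _ => hv0 t
  refine ⟨hL0, ?_⟩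
  set L := ∫ t in (0 : ℝ)..1, v t
  have key : ∀ ε > 0, ((T - 1) * (γ 0).mat * (T - 1)).trace ≤ (L + ε) * L := fun ε hε =>
    trace_le_sq_length hv hv0 hp hc (fun t ht => by
      rw [hve t ht, Real.sq_sqrt (metric_self (hp t) _)]) hT h1 hε
  -- Let `ε → 0`: the choice `ε = δ / (L + 1)` makes the error `ε L` at most `δ`.
  refine le_of_forall_pos_le_add fun δ hδ => ?_
  refine (key (δ / (L + 1)) (by positivity)).trans ?_
  have h2 : δ / (L + 1) * L ≤ δ := by
    rw [div_mul_eq_mul_div, div_le_iff₀ (by positivity)]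
    nlinarith
  nlinarith

/-! ### The distance formula; minimality and uniqueness of geodesics -/

theorem le_riemannianEDist {A B : SPD n} {T : Matrix (Fin n) (Fin n) ℝ} (hT : T.PosDef)
    (h : B.mat = T * A.mat * T) :
    ENNReal.ofReal (Real.sqrt ((T - 1) * A.mat * (T - 1)).trace)
      ≤ riemannianEDist 𝓘(ℝ, SymMat n) A B := by
  refine le_of_forall_gt fun r hr => ?_
  obtain ⟨γ, h0, h1, hγ, hlen⟩ := exists_lt_of_riemannianEDist_lt hr
  subst h0 h1
  exact (le_pathELength (contMDiffOn_iff_curve.1 hγ) hT h).trans_lt hlen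

/-- Since `1 + b G₀` is positive definite, the lower bound applies with `T - 1 = b G₀` and equals
the length `b` times the constant speed. -/
theorem IsGeodesicOn.isMinimizing {γ : ℝ → SPD n} {I : Set ℝ} (hγ : IsGeodesicOn γ I)
    (hI : UniqueDiffOn ℝ I) {b : ℝ} (hb : Icc 0 b ⊆ I) (h0 : 0 ≤ b) : IsMinimizing γ 0 b := by
  refine le_antisymm ?_ (riemannianEDist_le_pathELength (contMDiffOn_iff_curve.2
    ((hγ.1.mono hb).of_le one_le_two)) rfl rfl h0)
  obtain ⟨h1, h2, -⟩ := hγ.eq_flow hI hb rfl (right_mem_Icc.2 h0)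
  refine le_trans (le_of_eq ?_) (le_riemannianEDist h1 h2)
  rw [hγ.pathELength_eq hI hb h0 rfl, add_sub_cancel_left, smul_mul_assoc, smul_mul_assoc,
    mul_smul_comm, smul_smul, Matrix.trace_smul, smul_eq_mul, Real.sqrt_mul (mul_self_nonneg b),
    Real.sqrt_mul_self h0]

theorem riemannianEDist_eq {A B : SPD n} {T : Matrix (Fin n) (Fin n) ℝ} (hT : T.PosDef)
    (h : B.mat = T * A.mat * T) :
    riemannianEDist 𝓘(ℝ, SymMat n) A B
      = ENNReal.ofReal (Real.sqrt ((T - 1) * A.mat * (T - 1)).trace) := by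
  refine le_antisymm ?_ (le_riemannianEDist hT h)
  obtain ⟨γ, hγ, h0, h1⟩ := exists_geodesic A hT
  have hB : γ 1 = B := Subtype.ext (SymMat.mat_injective (h1.trans h.symm))
  subst h0 hB
  have hI := uniqueDiffOn_Icc (zero_lt_one (α := ℝ))
  obtain ⟨h2, h3, -⟩ := hγ.eq_flow hI subset_rfl rfl (right_mem_Icc.2 zero_le_one)
  have h4 := transport_unique (γ 0).posDef h2 hT (h3.symm.trans h)
  rw [← hγ.isMinimizing hI subset_rfl zero_le_one, hγ.pathELength_eq hI subset_rfl zero_le_one rfl,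
    ← h4, one_smul, add_sub_cancel_left, one_mul]

/-- For both curves `1 + G₀` is the unique positive-definite transport matrix between the end
points, so the `G₀` agree and determine the curves. -/
theorem IsGeodesicOn.eqOn {γ η : ℝ → SPD n} (hγ : IsGeodesicOn γ (Icc 0 1))
    (hη : IsGeodesicOn η (Icc 0 1)) (h0 : η 0 = γ 0) (h1 : η 1 = γ 1) :
    EqOn η γ (Icc 0 1) := by
  have hI := uniqueDiffOn_Icc (zero_lt_one (α := ℝ))
  obtain ⟨a1, a2, -⟩ := hγ.eq_flow hI subset_rfl rfl (right_mem_Icc.2 zero_le_one)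
  obtain ⟨b1, b2, -⟩ := hη.eq_flow hI subset_rfl rfl (right_mem_Icc.2 zero_le_one)
  rw [h0] at b1
  rw [h0, h1] at b2
  have h2 := transport_unique (γ 0).posDef b1 a1 (b2.symm.trans a2)
  rw [add_right_inj, one_smul, one_smul] at h2
  intro t ht
  have c1 := (hγ.eq_flow hI subset_rfl rfl ht).2.1
  have c2 := (hη.eq_flow hI subset_rfl (h2.symm.trans (by rw [h0])) ht).2.1
  rw [h0] at c2
  exact Subtype.ext (SymMat.mat_injective (c2.trans c1.symm))

end BuresWasserstein
theorem mainTheorem8 (n : ℕ) :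
    (∀ A₁ A₂ : SPD n,
      -- there is exactly one geodesic `[0, 1] → SPD(n)` from `A₁` to `A₂`, and it is minimizing
      (∃ γ : ℝ → SPD n,
        (IsGeodesicOn γ (Set.Icc 0 1) ∧ γ 0 = A₁ ∧ γ 1 = A₂) ∧
        IsMinimizing γ 0 1 ∧
        ∀ η : ℝ → SPD n, IsGeodesicOn η (Set.Icc 0 1) → η 0 = A₁ → η 1 = A₂ →
          Set.EqOn η γ (Set.Icc 0 1)) ∧
      -- `(A₁ A₂)^{1/2}` is well defined, and gives the geodesic distance
      (∃! R : Matrix (Fin n) (Fin n) ℝ, IsPrincipalSqrt (A₁.mat * A₂.mat) R) ∧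
      ∀ R : Matrix (Fin n) (Fin n) ℝ, IsPrincipalSqrt (A₁.mat * A₂.mat) R →
        0 ≤ A₁.mat.trace + A₂.mat.trace - 2 * R.trace ∧
        Manifold.riemannianEDist (modelWithCornersSelf ℝ (SymMat n)) A₁ A₂
          = ENNReal.ofReal (Real.sqrt (A₁.mat.trace + A₂.mat.trace - 2 * R.trace)) ∧
        -- the same number is the attained minimal distance between the two fibers
        IsLeast {r : ℝ | ∃ P₁ ∈ Matrix.orthogonalGroup (Fin n) ℝ,
            ∃ P₂ ∈ Matrix.orthogonalGroup (Fin n) ℝ,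
              r = frobNorm (P₁ * CFC.sqrt A₁.mat - P₂ * CFC.sqrt A₂.mat)}
          (Real.sqrt (A₁.mat.trace + A₂.mat.trace - 2 * R.trace))) ∧
    -- the set over which the minimum is taken indeed runs over the fibers
    (∀ A : SPD n, fiber A =
      {M | ∃ P ∈ Matrix.orthogonalGroup (Fin n) ℝ, M = P * CFC.sqrt A.mat}) ∧
    -- there is no cut locus
    ∀ A : SPD n, cutLocus A = ∅ := by
  refine ⟨fun A₁ A₂ => ?_, fun A => ?_, fun A => ?_⟩
  · obtain ⟨T, hT, hTe⟩ := exists_posDef_transport A₁.posDef A₂.posDef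
    have hR := isPrincipalSqrt_mul A₁.posDef hT
    rw [hTe] at hR
    obtain ⟨γ, hγ, h0, h1⟩ := exists_geodesic A₁ hT
    have hB : γ 1 = A₂ := Subtype.ext (SymMat.mat_injective (h1.trans hTe))
    refine ⟨⟨γ, ⟨hγ, h0, hB⟩, hγ.isMinimizing (uniqueDiffOn_Icc zero_lt_one) subset_rfl
      zero_le_one, fun η hη e0 e1 => hγ.eqOn hη (e0.trans h0.symm) (e1.trans hB.symm)⟩,
      ⟨_, hR, fun R' hR' => hR'.unique hR⟩, fun R hR' => ?_⟩
    rw [hR'.unique hR]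
    have hleast := isLeast_frobNorm_sub A₁.posDef hT
    rw [hTe] at hleast
    have htr := trace_add_trace_sub (A := A₁.mat) (T := T)
    rw [hTe] at htr
    refine ⟨?_, ?_, hleast⟩
    · rw [htr]
      have hs : (T - 1)ᵀ = T - 1 := by simp [(isSymm_of_posDef hT).eq]
      have := (A₁.posDef.posSemidef.mul_mul_conjTranspose_same (T - 1)).trace_nonneg
      rwa [Matrix.conjTranspose_eq_transpose_of_trivial, hs] at this
    · rw [htr, riemannianEDist_eq hT hTe.symm]
  · ext M
    exact ⟨fun h => (fiber_eq_orthogonal_mul_sqrt A.posDef M).1 h.2, fun h =>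
      have h' := (fiber_eq_orthogonal_mul_sqrt A.posDef M).2 h
      ⟨isUnit_of_transpose_mul_self A.posDef h', h'⟩⟩
  · rw [Set.eq_empty_iff_forall_notMem]
    rintro B ⟨γ, b, t₀, -, ⟨hγ, -, h0, hb, -, hmin⟩, -⟩
    -- A geodesic on `[0, b)` minimizes up to every `t < b`, so any `t` past `t₀` refutes the cut
    -- time.
    obtain ⟨t, ht, htb⟩ := exists_between hb
    exact hmin t ht htb (hγ.isMinimizing (uniqueDiffOn_Ico 0 b)
      (fun s hs => ⟨hs.1, hs.2.trans_lt htb⟩) (h0.trans ht).le)
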